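/- **Theorem 1 (Bulk-boundary correspondence).** Let $(t_n)_{n\in\mathbb Z}$ be real couplings with $\sum_n |t_n|<\infty$, and consider the half-infinite open chain $$H=\frac{\mathrm i}{2}\sum_{n,m\ge 0} t_{m-n}\,\tilde\gamma_n\gamma_m ,$$ where $\gamma_n=c_n+c_n^\dagger$ and $\tilde\gamma_n=\mathrm i(c_n^\dagger-c_n)$ are the Majorana operators of fermionic modes $c_n$ ($n\ge 0$) acting on Fock space. Here $[x,H]$ denotes the norm-convergent sum of the commutators of $x$ with the individual terms of $H$. A real-coefficient sum $\gamma_L=\sum_{n\ge0}g_n\gamma_n$ or $\tilde\gamma_L=\sum_{n\ge0}g_n\tilde\gamma_n$ is a *zero-energy edge mode* if it is normalisable, $\sum_n g_n^2<\infty$, and commutes with $H$. Put $f(z)=\sum_{n\in\mathbb Z}t_nz^n$ for $|z|=1$. Suppose the bulk is gapped, i.e. $f(z)\neq0$ for $|z|=1$, and let $\omega\in\mathbb Z$ be the winding number of $f$: a continuous choice of $\arg f(\mathrm e^{\mathrm i\theta})$ grows by $2\pi\omega$ as $\theta$ goes from $0$ to $2\pi$. Write $(h(z))_k=\frac1{2\pi\mathrm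 i}\oint_{|z|=1}h(z)z^{-(k+1)}\,\mathrm dz$. Then: 1. There are $|\omega|$ linearly independent zero-energy edge modes. 2. The function $z^{-\omega}f(z)$ has a continuous logarithm on the unit circle. For every such logarithm $V$, with $V_k=(V(z))_k$, one has $\sum_k|V_k|<\infty$. Setting $b_\pm(z)=\exp\big(\sum_{k\ge1}V_{\pm k}z^{\pm k}\big)$, the function $b_+$ is analytic in $|z|<1$, $b_-$ is analytic in $|z|>1$, and $f(z)=\mathrm e^{V_0}z^\omega b_+(z)b_-(z)$ on $|z|=1$. In particular, $f(z)=z^\omega b_+(z)b_-(z)$ in the normalisation $V_0=0$. 3. If $\omega>0$, the operators $\gamma_L^{(m)}=\sum_{n\ge0}g^{(m)}_n\gamma_n$, $0\le m\le\omega-1$, with $$g^{(m)}_n=\Big(\frac1{b_-(1/z)}\Big)_{n-m}\in\mathbb R ,$$ are linearly independent zero-energy edge modes. 4. If $\omega<0$, the operators $\tilde\gamma_L^{(m)}=\sum_{n\ge0}g^{(m)}_n\tilde\gamma_n$, $0\le m\le|\omega|-1$, with $g^{(m)}_n=\Big(\dfrac1{b_+(z)}\Big)_{n-m}\in\mathbb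 R$, are linearly independent zero-energy edge modes. -/

import Mathlib

noncomputable section

namespace BDIChain

/-! ### Fermions on the half-infinite chain with sites `0, 1, 2, …` -/

/-- The fermionic Fock space of the half-infinite chain: a basis vector is a finite set
of occupied sites. -/
abbrev Fock : Type := lp (fun _ : Finset ℕ => ℂ) 2

/-- Bounded operators on Fock space, with the operator norm. -/
abbrev FockOp : Type := Fock →L[ℂ] Fock

/-- Change the occupation of the site `n`. -/
def toggle (n : ℕ) : Finset ℕ ≃ Finset ℕ :=
  (symmDiff_left_involutive ({n} : Finset ℕ)).toPerm

/-- The sign `(-1)^(number of occupied sites to the left of n)`. -/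
def leftSign (n : ℕ) (S : Finset ℕ) : ℂ := (-1) ^ (S.filter (· < n)).card

/-- Amplitudes of the state `c_n ψ`. -/
def annihilateFun (n : ℕ) (ψ : Finset ℕ → ℂ) (S : Finset ℕ) : ℂ :=
  if n ∈ S then 0 else leftSign n S * ψ (insert n S)

theorem norm_annihilateFun_le (n : ℕ) (ψ : Finset ℕ → ℂ) (S : Finset ℕ) :
    ‖annihilateFun n ψ S‖ ≤ ‖ψ (toggle n S)‖ := by
  unfold annihilateFun
  split_ifs with h
  · simp
  · have h1 : toggle n S = insert n S := by
      ext k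
      simp only [toggle, Function.Involutive.coe_toPerm, Finset.mem_symmDiff,
        Finset.mem_singleton, Finset.mem_insert]
      by_cases hk : k = n
      · subst hk; simp [h]
      · simp [hk]
    rw [h1, norm_mul]
    simp [leftSign]

theorem summable_toggle (n : ℕ) (ψ : Fock) :
    Summable fun S => ‖ψ (toggle n S)‖ ^ (2 : ENNReal).toReal :=
  ((toggle n).summable_iff (f := fun S => ‖ψ S‖ ^ (2 : ENNReal).toReal)).2
    ((lp.memℓp ψ).summable (by norm_num))

theorem annihilateFun_rpow_le (n : ℕ) (ψ : Fock) (S : Finset ℕ) :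
    ‖annihilateFun n ψ S‖ ^ (2 : ENNReal).toReal ≤ ‖ψ (toggle n S)‖ ^ (2 : ENNReal).toReal :=
  Real.rpow_le_rpow (norm_nonneg _) (norm_annihilateFun_le n ψ S) (by norm_num)

theorem memℓp_annihilateFun (n : ℕ) (ψ : Fock) :
    Memℓp (E := fun _ : Finset ℕ => ℂ) (annihilateFun n ψ) 2 :=
  memℓp_gen ((summable_toggle n ψ).of_nonneg_of_le
    (fun _ => Real.rpow_nonneg (norm_nonneg _) _) (annihilateFun_rpow_le n ψ))

/-- The fermionic annihilation operator `c_n` of the site `n`. -/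
def annihilate (n : ℕ) : FockOp :=
  LinearMap.mkContinuous
    { toFun := fun ψ => ⟨annihilateFun n ψ, memℓp_annihilateFun n ψ⟩
      map_add' := fun ψ χ => by
        apply Subtype.ext; funext S
        change annihilateFun n (⇑(ψ + χ)) S = annihilateFun n ψ S + annihilateFun n χ S
        unfold annihilateFun
        split_ifs <;> simp [mul_add]
      map_smul' := fun a ψ => by
        apply Subtype.ext; funext S
        change annihilateFun n (⇑(a • ψ)) S = a * annihilateFun n ψ S
        unfold annihilateFun
        split_ifs <;> simp [mul_left_comm] }
    1 (fun ψ => by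
      rw [one_mul]
      refine lp.norm_le_of_forall_sum_le (by norm_num) (norm_nonneg _) (fun s => ?_)
      rw [lp.norm_rpow_eq_tsum (by norm_num) ψ,
        ← (toggle n).tsum_eq (fun S => ‖ψ S‖ ^ (2 : ENNReal).toReal)]
      exact (Finset.sum_le_sum fun S _ => annihilateFun_rpow_le n ψ S).trans
        ((summable_toggle n ψ).sum_le_tsum s
          (fun _ _ => Real.rpow_nonneg (norm_nonneg _) _)))

/-- The creation operator `c_n†`. -/
def create (n : ℕ) : FockOp := ContinuousLinearMap.adjoint (annihilate n)

/-- The real Majorana operator `γ_n = c_n + c_n†`. -/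
def majorana (n : ℕ) : FockOp := annihilate n + create n

/-- The imaginary Majorana operator `γ̃_n = i (c_n† - c_n)`. -/
def majoranaTilde (n : ℕ) : FockOp := Complex.I • (create n - annihilate n)

/-! ### The half-infinite open chain and its zero modes -/

/-- The term `(i/2) t_{m-n} γ̃_n γ_m`, for `p = (n, m)`, of the half-infinite open chain
`H = (i/2) ∑_{n,m ≥ 0} t_{m-n} γ̃_n γ_m`. -/
def hamiltonianTerm (t : ℤ → ℝ) (p : ℕ × ℕ) : FockOp :=
  (Complex.I / 2 * (t ((p.2 : ℤ) - (p.1 : ℤ)) : ℂ)) • (majoranaTilde p.1 * majorana p.2)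

/-- `[x, H] = 0`. The formal series `H` is not itself an operator; its commutator with `x` is
the unconditionally norm-convergent series of the commutators of `x` with the terms of `H`. -/
def CommutesWithHamiltonian (t : ℤ → ℝ) (x : FockOp) : Prop :=
  HasSum (fun p : ℕ × ℕ => x * hamiltonianTerm t p - hamiltonianTerm t p * x) 0

/-- `x = ∑_{n ≥ 0} g_n χ_n` is a normalisable zero mode with real coefficients `g_n`,
where `χ` is one of the two families of Majorana operators. -/
structure IsZeroMode (t : ℤ → ℝ) (χ : ℕ → FockOp) (g : ℕ → ℝ) (x : FockOp) : Prop where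
  normalisable : Summable fun n => g n ^ 2
  expansion : HasSum (fun n => (g n : ℂ) • χ n) x
  zero_energy : CommutesWithHamiltonian t x

/-- A (real or imaginary chiral) zero-energy edge mode of the half-infinite open chain. -/
def IsEdgeMode (t : ℤ → ℝ) (x : FockOp) : Prop :=
  ∃ g : ℕ → ℝ, IsZeroMode t majorana g x ∨ IsZeroMode t majoranaTilde g x

/-! ### The bulk: symbol, gap, winding number, Wiener-Hopf factors -/

/-- `f(z) = ∑_{n ∈ ℤ} t_n z^n`. -/
def symbol (t : ℤ → ℝ) (z : ℂ) : ℂ := ∑' n : ℤ, (t n : ℂ) * z ^ n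

/-- The bulk Hamiltonian is gapped: `f` has no zero on the unit circle. -/
def IsGapped (t : ℤ → ℝ) : Prop := ∀ z : ℂ, ‖z‖ = 1 → symbol t z ≠ 0

/-- `h` has winding number `ω` around `0` along the unit circle: a continuous choice of the
argument of `h(e^{iθ})` grows by `2πω` as `θ` runs from `0` to `2π`. -/
def HasWindingNumber (h : ℂ → ℂ) (ω : ℤ) : Prop :=
  ∃ φ : ℝ → ℝ, ContinuousOn φ (Set.Icc 0 (2 * Real.pi)) ∧
    (∀ θ ∈ Set.Icc (0 : ℝ) (2 * Real.pi),
      h (Complex.exp (θ * Complex.I)) =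
        ‖h (Complex.exp (θ * Complex.I))‖ * Complex.exp (φ θ * Complex.I)) ∧
    φ (2 * Real.pi) - φ 0 = 2 * Real.pi * ω

/-- The Fourier coefficient `(h(z))_k = (2πi)⁻¹ ∮ h(z) z^{-(k+1)} dz` over the unit circle. -/
def coeff (h : ℂ → ℂ) (k : ℤ) : ℂ :=
  (2 * Real.pi * Complex.I)⁻¹ * ∮ z in C(0, 1), h z * z ^ (-(k + 1))

/-- `V` is a continuous logarithm on the unit circle of `f₀(z) = z^{-ω} f(z)`. -/
def IsContinuousLog (t : ℤ → ℝ) (ω : ℤ) (V : ℂ → ℂ) : Prop :=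
  ContinuousOn V (Metric.sphere 0 1) ∧
    ∀ z : ℂ, ‖z‖ = 1 → Complex.exp (V z) = z ^ (-ω) * symbol t z

/-- `b₊(z) = exp (∑_{k ≥ 1} V_k z^k)`. -/
def bPlus (V : ℂ → ℂ) (z : ℂ) : ℂ :=
  Complex.exp (∑' k : ℕ, coeff V ((k : ℤ) + 1) * z ^ ((k : ℤ) + 1))

/-- `b₋(z) = exp (∑_{k ≥ 1} V_{-k} z^{-k})`. -/
def bMinus (V : ℂ → ℂ) (z : ℂ) : ℂ :=
  Complex.exp (∑' k : ℕ, coeff V (-((k : ℤ) + 1)) * z ^ (-((k : ℤ) + 1)))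

end BDIChain

end

open BDIChain

noncomputable section

namespace BDIChain

/-! ### The Majorana operators and their anticommutation relations -/

/-! The commutator of `x = ∑ g_m γ_m` with `γ̃_n γ_m` is the single term `-2 g_m γ̃_n`, because `x`
anticommutes with `γ̃_n` and `{x, γ_m}` is the scalar `2 g_m` (`IsClifford.commutator`). Hence `x`
commutes with `H` as soon as `g` lies in the kernel of the half-infinite Toeplitz matrix with symbol
`f(1/z)`. For `γ̃` modes the matrix is transposed and the symbol is `f(z)`.

The Wiener-Hopf factorization supplies kernel vectors. If `ω > 0`, then `f(1/z) / b₋(1/z) = e^{V_0}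
z^{-ω} b₊(1/z)` has only degrees `≤ -ω`. Multiplying by `z^m` with `m < ω` leaves only negative
degrees, so every row `n ≥ 0` of the Toeplitz system vanishes (`hasSum_toeplitz_eq_zero`). If `ω <
0`, the same argument works with `f(z) / b₊(z)`. The `|ω|` shifts of one power series with nonzero
constant term are independent by triangularity (`IsClifford.linearIndependent`).

The analytic core is that a continuous logarithm of an absolutely convergent Laurent series is again
one (`HasLaurent.exists_log`). Write `f = p · (f/p)` with `p` a nearby trigonometric polynomial. The
logarithm of `f/p` is a convergent power series in `(f - p)/p`, and a continuous logarithm of `p` is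
continuously differentiable, so its Fourier coefficients are summable by Parseval. Exponentials then
stay in the algebra and keep one-sided support (`LaurentBound.exp`). -/

theorem mem_toggle {n k : ℕ} {S : Finset ℕ} : k ∈ toggle n S ↔ (k ∈ S ↔ k ≠ n) := by
  simp only [toggle, Function.Involutive.coe_toPerm, Finset.mem_symmDiff, Finset.mem_singleton]
  tauto

theorem toggle_of_notMem {n : ℕ} {S : Finset ℕ} (h : n ∉ S) : toggle n S = insert n S := by
  ext k
  rw [mem_toggle, Finset.mem_insert]
  by_cases hk : k = n
  · subst hk; simp [h]
  · simp [hk]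

theorem toggle_of_mem {n : ℕ} {S : Finset ℕ} (h : n ∈ S) : toggle n S = S.erase n := by
  ext k
  rw [mem_toggle, Finset.mem_erase]
  by_cases hk : k = n
  · subst hk; simp [h]
  · simp [hk]

theorem toggle_toggle (n : ℕ) (S : Finset ℕ) : toggle n (toggle n S) = S := by
  ext k
  simp only [mem_toggle]
  tauto

theorem toggle_comm (n m : ℕ) (S : Finset ℕ) : toggle n (toggle m S) = toggle m (toggle n S) := by
  ext k
  simp only [mem_toggle]
  tauto

theorem leftSign_mul_self (n : ℕ) (S : Finset ℕ) : leftSign n S * leftSign n S = 1 := by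
  rw [leftSign, ← mul_pow]
  simp

theorem leftSign_insert {n m : ℕ} {S : Finset ℕ} (h : n ∉ S) :
    leftSign m (insert n S) = if n < m then -leftSign m S else leftSign m S := by
  unfold leftSign
  rw [Finset.filter_insert]
  split_ifs with hnm
  · rw [Finset.card_insert_of_notMem (by simp [h]), pow_succ]
    simp
  · rfl

theorem leftSign_toggle (n m : ℕ) (S : Finset ℕ) :
    leftSign m (toggle n S) = if n < m then -leftSign m S else leftSign m S := by
  by_cases h : n ∈ S
  · have h2 := leftSign_insert (m := m) (Finset.notMem_erase n S)
    rw [Finset.insert_erase h] at h2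
    rw [toggle_of_mem h, h2]
    split_ifs <;> simp
  · rw [toggle_of_notMem h, leftSign_insert h]

theorem annihilate_apply (n : ℕ) (ψ : Fock) (S : Finset ℕ) :
    annihilate n ψ S = if n ∈ S then 0 else leftSign n S * ψ (toggle n S) := by
  change annihilateFun n ψ S = _
  unfold annihilateFun
  split_ifs with h
  · rfl
  · rw [toggle_of_notMem h]

theorem annihilate_single (n : ℕ) (S : Finset ℕ) :
    annihilate n (lp.single 2 S (1 : ℂ)) =
      lp.single 2 (toggle n S) (if n ∈ S then leftSign n S else 0) := by
  apply lp.ext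
  funext T
  rw [annihilate_apply, lp.single_apply, lp.single_apply]
  by_cases hT : T = toggle n S
  · subst hT
    simp [toggle_toggle, leftSign_toggle, mem_toggle]
  · have : toggle n T ≠ S := fun h => hT (by rw [← h, toggle_toggle])
    simp [hT, this]

/-- An amplitude is an inner product with a basis vector, so the adjoint is computed from the action
of `annihilate` on basis vectors. -/
theorem create_apply (n : ℕ) (ψ : Fock) (S : Finset ℕ) :
    create n ψ S = if n ∈ S then leftSign n S * ψ (toggle n S) else 0 := by
  have h1 : inner ℂ (lp.single 2 S (1 : ℂ) : Fock) (create n ψ) = create n ψ S := by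
    rw [lp.inner_single_left]
    simp
  rw [← h1, create, ContinuousLinearMap.adjoint_inner_right, annihilate_single,
    lp.inner_single_left]
  split_ifs with h
  · simp [leftSign, mul_comm]
  · simp

/-- The Jordan-Wigner form, uniform in the occupation of `n`: it reduces the anticommutation
relations to signs under toggling. -/
theorem majorana_apply (n : ℕ) (ψ : Fock) (S : Finset ℕ) :
    majorana n ψ S = leftSign n S * ψ (toggle n S) := by
  change annihilate n ψ S + create n ψ S = _
  rw [annihilate_apply, create_apply]
  split_ifs <;> simp

/-- The eigenvalue `±1` of `2 c_n† c_n - 1` on a basis vector. -/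
def occupationSign (n : ℕ) (S : Finset ℕ) : ℂ := if n ∈ S then 1 else -1

theorem occupationSign_toggle (n m : ℕ) (S : Finset ℕ) :
    occupationSign m (toggle n S) = if n = m then -occupationSign m S else occupationSign m S := by
  unfold occupationSign
  by_cases h : n = m
  · subst h
    by_cases h' : n ∈ S <;> simp [mem_toggle, h']
  · simp [mem_toggle, h, Ne.symm h]

theorem occupationSign_mul_self (n : ℕ) (S : Finset ℕ) :
    occupationSign n S * occupationSign n S = 1 := by
  unfold occupationSign
  split_ifs <;> simp

theorem majoranaTilde_apply (n : ℕ) (ψ : Fock) (S : Finset ℕ) :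
    majoranaTilde n ψ S = Complex.I * (occupationSign n S * leftSign n S * ψ (toggle n S)) := by
  change Complex.I * (create n ψ S - annihilate n ψ S) = _
  rw [annihilate_apply, create_apply, occupationSign]
  split_ifs <;> simp

/-- The operators `χ n` generate a Clifford algebra. -/
def IsClifford (χ : ℕ → FockOp) : Prop :=
  ∀ n m, χ n * χ m + χ m * χ n = if n = m then 2 else 0

/-- For distinct sites, toggling the lower one flips `leftSign` of the higher one and not
conversely, so the two orders cancel. For equal sites the sign squares to `1`. -/
theorem majorana_isClifford : IsClifford majorana := by
  intro n m
  ext ψ S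
  change majorana n (majorana m ψ) S + majorana m (majorana n ψ) S = _
  simp only [majorana_apply, leftSign_toggle]
  rcases lt_trichotomy n m with h | rfl | h
  · rw [toggle_comm m n, if_pos h, if_neg h.not_gt, if_neg h.ne]
    change _ = (0 : ℂ)
    ring
  · rw [toggle_toggle, if_neg (lt_irrefl n), if_pos rfl, ← mul_assoc, leftSign_mul_self]
    rw [show (2 : FockOp) = 1 + 1 by norm_num]
    change _ = ψ S + ψ S
    ring
  · rw [toggle_comm m n, if_pos h, if_neg h.not_gt, if_neg h.ne']
    change _ = (0 : ℂ)
    ring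

theorem majoranaTilde_isClifford : IsClifford majoranaTilde := by
  intro n m
  ext ψ S
  change majoranaTilde n (majoranaTilde m ψ) S + majoranaTilde m (majoranaTilde n ψ) S = _
  simp only [majoranaTilde_apply, leftSign_toggle, occupationSign_toggle]
  rcases lt_trichotomy n m with h | rfl | h
  · rw [toggle_comm m n, if_pos h, if_neg h.not_gt, if_neg h.ne, if_neg h.ne, if_neg h.ne']
    change _ = (0 : ℂ)
    ring
  · rw [toggle_toggle, if_neg (lt_irrefl n), if_pos rfl, if_pos rfl]
    rw [show (2 : FockOp) = 1 + 1 by norm_num]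
    change _ = ψ S + ψ S
    linear_combination (-2 * ψ S * occupationSign n S ^ 2 * leftSign n S ^ 2) * Complex.I_sq
      + 2 * ψ S * occupationSign n S ^ 2 * leftSign_mul_self n S
      + 2 * ψ S * occupationSign_mul_self n S
  · rw [toggle_comm m n, if_pos h, if_neg h.not_gt, if_neg h.ne', if_neg h.ne', if_neg h.ne]
    change _ = (0 : ℂ)
    ring

/-- At distinct sites `leftSign` gives the minus sign; at equal sites it comes from
`occupationSign`, which flips under the toggle. -/
theorem majoranaTilde_mul_majorana (n m : ℕ) :
    majoranaTilde n * majorana m = -(majorana m * majoranaTilde n) := by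
  ext ψ S
  change majoranaTilde n (majorana m ψ) S = -(majorana m (majoranaTilde n ψ) S)
  simp only [majorana_apply, majoranaTilde_apply, leftSign_toggle, occupationSign_toggle]
  rcases lt_trichotomy n m with h | rfl | h
  · rw [toggle_comm m n, if_pos h, if_neg h.not_gt, if_neg h.ne']
    ring
  · rw [if_neg (lt_irrefl n), if_pos rfl]
    ring
  · rw [toggle_comm m n, if_pos h, if_neg h.not_gt, if_neg h.ne]
    ring

theorem norm_annihilate_le (n : ℕ) : ‖annihilate n‖ ≤ 1 :=
  LinearMap.mkContinuous_norm_le _ zero_le_one _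

theorem norm_create_le (n : ℕ) : ‖create n‖ ≤ 1 := by
  rw [create, LinearIsometryEquiv.norm_map]
  exact norm_annihilate_le n

theorem norm_majorana_le (n : ℕ) : ‖majorana n‖ ≤ 2 :=
  (norm_add_le _ _).trans (by linarith [norm_annihilate_le n, norm_create_le n])

theorem norm_majoranaTilde_le (n : ℕ) : ‖majoranaTilde n‖ ≤ 2 := by
  rw [majoranaTilde, norm_smul, Complex.norm_I, one_mul]
  exact (norm_sub_le _ _).trans (by linarith [norm_annihilate_le n, norm_create_le n])

/-! ### Zero modes from the kernel of a half-infinite Toeplitz matrix -/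

/-- Only the `m`-th term of the expansion has a nonzero anticommutator with `χ m`; this extracts a
coefficient from an operator. -/
theorem IsClifford.anticommutator {χ : ℕ → FockOp} (hχ : IsClifford χ) {g : ℕ → ℂ}
    {x : FockOp} (hx : HasSum (fun n => g n • χ n) x) (m : ℕ) :
    x * χ m + χ m * x = (2 * g m) • (1 : FockOp) := by
  have h := (hx.mul_right (χ m)).add (hx.mul_left (χ m))
  have e : ∀ n, g n • χ n * χ m + χ m * g n • χ n =
      if n = m then (2 * g m) • (1 : FockOp) else 0 := by
    intro n
    rw [smul_mul_assoc, mul_smul_comm, ← smul_add, hχ]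
    split_ifs with hn
    · subst hn
      rw [show (2 : FockOp) = (2 : ℂ) • 1 by rw [two_smul]; norm_num, smul_smul, mul_comm]
    · simp
  simp only [e] at h
  exact h.unique (hasSum_ite_eq m _)

/-- Clifford expansions have unique coefficients, so a unitriangular family of them is linearly
independent. -/
theorem IsClifford.linearIndependent {χ : ℕ → FockOp} (hχ : IsClifford χ) {N : ℕ}
    {g : Fin N → ℕ → ℂ} {Γ : Fin N → FockOp} (hΓ : ∀ m, HasSum (fun n => g m n • χ n) (Γ m))
    (h0 : ∀ (m : Fin N) (n : ℕ), n < m → g m n = 0) (h1 : ∀ m : Fin N, g m m ≠ 0) :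
    LinearIndependent ℂ Γ := by
  rw [Fintype.linearIndependent_iff]
  intro c hc
  -- Anticommuting the vanishing combination with `χ n` isolates its `n`-th coefficient.
  have key : ∀ n : ℕ, ∑ m, c m * g m n = 0 := by
    intro n
    have h : HasSum (fun k => (∑ m, c m * g m k) • χ k) (0 : FockOp) := by
      rw [← hc]
      convert hasSum_sum (s := Finset.univ) fun m _ => (hΓ m).const_smul (c m) using 2 with k
      rw [Finset.sum_smul]
      simp only [smul_smul]
    have h2 := hχ.anticommutator h n
    rw [zero_mul, mul_zero, add_zero] at h2
    have h3 := h2.symm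
    rw [smul_eq_zero] at h3
    rcases h3 with h3 | h3
    · simpa using h3
    · exfalso
      -- The identity operator is nonzero: evaluate it on the vacuum.
      have h4 := DFunLike.congr_fun h3 (lp.single 2 ∅ (1 : ℂ))
      have h5 := congrArg (fun ψ : Fock => ψ ∅) h4
      simp [lp.single_apply] at h5
  -- Forward substitution: equation `k` involves only `c 0, …, c k`.
  have : ∀ k : ℕ, ∀ hk : k < N, c ⟨k, hk⟩ = 0 := by
    intro k
    induction k using Nat.strong_induction_on with
    | _ k ih =>
      intro hk
      have h := key k
      rw [Finset.sum_eq_single ⟨k, hk⟩] at h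
      · exact (mul_eq_zero.1 h).resolve_right (h1 ⟨k, hk⟩)
      · intro b _ hb
        rcases lt_trichotomy (b : ℕ) k with hlt | heq | hgt
        · rw [ih b hlt b.2, zero_mul]
        · exact absurd (Fin.ext heq) hb
        · rw [h0 b k hgt, mul_zero]
      · simp
  exact fun i => this i i.2

/-- Moving `x` past `η n` costs a sign, which turns the commutator into `-η n` times the scalar
anticommutator of `x` and `χ m`. -/
theorem IsClifford.commutator {χ η : ℕ → FockOp} (hχ : IsClifford χ)
    (hχη : ∀ n m, χ n * η m = -(η m * χ n)) {g : ℕ → ℂ} {x : FockOp}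
    (hx : HasSum (fun n => g n • χ n) x) (n m : ℕ) :
    x * (η n * χ m) - (η n * χ m) * x = (-2 * g m) • η n := by
  have h1 : x * η n = -(η n * x) := by
    have e : ∀ k, g k • χ k * η n = -(η n * g k • χ k) := fun k => by
      rw [smul_mul_assoc, mul_smul_comm, hχη, smul_neg]
    have h := hx.mul_right (η n)
    simp only [e] at h
    exact h.unique (hx.mul_left (η n)).neg
  have h2 := hχ.anticommutator hx m
  calc x * (η n * χ m) - (η n * χ m) * x
      = (x * η n) * χ m - η n * (χ m * x) := by simp only [mul_assoc]
    _ = -(η n * (x * χ m + χ m * x)) := by rw [h1, mul_add]; simp only [mul_assoc, neg_mul]; abel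
    _ = (-2 * g m) • η n := by rw [h2]; simp

/-- If `g` is annihilated by the Toeplitz matrix `w (n - m)`, then `∑ g_m χ_m` commutes with
`∑ c w (n - m) η_n χ_m`. -/
theorem IsClifford.hasSum_commutator {χ η : ℕ → FockOp} (hχ : IsClifford χ)
    (hχη : ∀ n m, χ n * η m = -(η m * χ n)) (hη : ∀ n, ‖η n‖ ≤ 2) {g : ℕ → ℂ}
    (hg : Summable fun n => ‖g n‖) {x : FockOp} (hx : HasSum (fun n => g n • χ n) x)
    {w : ℤ → ℂ} (hw : Summable fun n => ‖w n‖)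
    (hker : ∀ n : ℕ, HasSum (fun m : ℕ => w ((n : ℤ) - m) * g m) 0) (c : ℂ) :
    HasSum (fun p : ℕ × ℕ => x * ((c * w ((p.1 : ℤ) - p.2)) • (η p.1 * χ p.2)) -
      ((c * w ((p.1 : ℤ) - p.2)) • (η p.1 * χ p.2)) * x) 0 := by
  have hterm : ∀ p : ℕ × ℕ, x * ((c * w ((p.1 : ℤ) - p.2)) • (η p.1 * χ p.2)) -
      ((c * w ((p.1 : ℤ) - p.2)) • (η p.1 * χ p.2)) * x =
      (-2 * c) • ((w ((p.1 : ℤ) - p.2) * g p.2) • η p.1) := by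
    intro p
    rw [mul_smul_comm, smul_mul_assoc, ← smul_sub, hχ.commutator hχη hx, smul_smul, smul_smul]
    congr 1
    ring
  simp only [hterm]
  suffices HasSum (fun p : ℕ × ℕ => (w ((p.1 : ℤ) - p.2) * g p.2) • η p.1) 0 by
    have h := this.const_smul (-2 * c)
    rwa [smul_zero] at h
  -- Vanishing rows alone do not give an unconditional sum over pairs. The majorant is the product
  -- series in `(n - m, m)`, restricted along an injection.
  have hsum : Summable fun p : ℕ × ℕ => (w ((p.1 : ℤ) - p.2) * g p.2) • η p.1 := by
    have h1 : Summable fun q : ℤ × ℕ => ‖w q.1‖ * ‖g q.2‖ :=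
      hw.mul_of_nonneg hg (fun _ => norm_nonneg _) (fun _ => norm_nonneg _)
    have hinj : Function.Injective fun p : ℕ × ℕ => (((p.1 : ℤ) - p.2, p.2) : ℤ × ℕ) := by
      rintro ⟨a, b⟩ ⟨a', b'⟩ h
      simp only [Prod.mk.injEq] at h ⊢
      omega
    refine Summable.of_norm_bounded ((h1.comp_injective hinj).mul_right 2) fun p => ?_
    rw [norm_smul, norm_mul]
    exact mul_le_mul_of_nonneg_left (hη _) (by positivity)
  have h := hsum.hasSum
  have h2 : ∀ n : ℕ, HasSum (fun m : ℕ => (w ((n : ℤ) - m) * g m) • η n) 0 := by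
    intro n
    have := (hker n).smul_const (η n)
    rwa [zero_smul] at this
  have h3 := h.prod_fiberwise h2
  rwa [h3.unique hasSum_zero] at h

open MeasureTheory

/-! ### Absolutely convergent Laurent series on the unit circle -/

/-- `h` is the sum of the absolutely convergent Laurent series with coefficients `a` on the
unit circle. -/
def HasLaurent (a : ℤ → ℂ) (h : ℂ → ℂ) : Prop :=
  (Summable fun n => ‖a n‖) ∧ ∀ z : ℂ, ‖z‖ = 1 → HasSum (fun n => a n * z ^ n) (h z)

/-- `h` has an absolutely convergent Laurent series on the unit circle, with exponents in `S` and
with norms of the coefficients summing up to at most `M`. -/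
def LaurentBound (S : AddSubmonoid ℤ) (M : ℝ) (h : ℂ → ℂ) : Prop :=
  ∃ a, HasLaurent a h ∧ ∑' n, ‖a n‖ ≤ M ∧ ∀ n ∉ S, a n = 0

theorem norm_zpow_of_norm_eq_one {z : ℂ} (hz : ‖z‖ = 1) (n : ℤ) : ‖z ^ n‖ = 1 := by
  rw [norm_zpow, hz, one_zpow]

theorem ne_zero_of_norm_eq_one {z : ℂ} (hz : ‖z‖ = 1) : z ≠ 0 := by
  rintro rfl
  simp at hz

theorem norm_exp_mul_I (θ : ℝ) : ‖Complex.exp (θ * Complex.I)‖ = 1 :=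
  Complex.norm_exp_ofReal_mul_I θ

theorem HasLaurent.congr {a : ℤ → ℂ} {h k : ℂ → ℂ} (ha : HasLaurent a h)
    (hk : ∀ z : ℂ, ‖z‖ = 1 → h z = k z) : HasLaurent a k :=
  ⟨ha.1, fun z hz => hk z hz ▸ ha.2 z hz⟩

theorem HasLaurent.norm_le {a : ℤ → ℂ} {h : ℂ → ℂ} (ha : HasLaurent a h) {z : ℂ} (hz : ‖z‖ = 1) :
    ‖h z‖ ≤ ∑' n, ‖a n‖ := by
  rw [← (ha.2 z hz).tsum_eq]
  refine tsum_of_norm_bounded ha.1.hasSum fun n => ?_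
  rw [norm_mul, norm_zpow_of_norm_eq_one hz, mul_one]

theorem HasLaurent.continuousOn {a : ℤ → ℂ} {h : ℂ → ℂ} (ha : HasLaurent a h) :
    ContinuousOn h (Metric.sphere 0 1) := by
  have h1 : ContinuousOn (fun z : ℂ => ∑' n, a n * z ^ n) (Metric.sphere 0 1) := by
    refine continuousOn_tsum (fun n z hz => ?_) ha.1 fun n z hz => ?_
    · refine ContinuousAt.continuousWithinAt (continuousAt_const.mul ?_)
      exact continuousAt_zpow₀ z n (.inl (ne_zero_of_norm_eq_one (by simpa using hz)))
    · rw [norm_mul, norm_zpow_of_norm_eq_one (by simpa using hz), mul_one]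
  exact h1.congr fun z hz => ((ha.2 z (by simpa using hz)).tsum_eq).symm

theorem HasLaurent.const_mul {a : ℤ → ℂ} {h : ℂ → ℂ} (ha : HasLaurent a h) (c : ℂ) :
    HasLaurent (fun n => c * a n) (fun z => c * h z) := by
  refine ⟨by simpa using ha.1.mul_left ‖c‖, fun z hz => ?_⟩
  simpa only [mul_assoc] using (ha.2 z hz).mul_left c

theorem HasLaurent.add {a b : ℤ → ℂ} {h k : ℂ → ℂ} (ha : HasLaurent a h) (hb : HasLaurent b k) :
    HasLaurent (fun n => a n + b n) (fun z => h z + k z) := by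
  refine ⟨(ha.1.add hb.1).of_nonneg_of_le (fun _ => norm_nonneg _) (fun _ => norm_add_le _ _),
    fun z hz => ?_⟩
  simpa only [add_mul] using (ha.2 z hz).add (hb.2 z hz)

theorem HasLaurent.zpow_mul {a : ℤ → ℂ} {h : ℂ → ℂ} (ha : HasLaurent a h) (N : ℤ) :
    HasLaurent (fun n => a (n - N)) (fun z => z ^ N * h z) := by
  refine ⟨(Equiv.subRight N).summable_iff.2 ha.1, fun z hz => ?_⟩
  have h1 := (Equiv.subRight N).hasSum_iff.2 ((ha.2 z hz).mul_left (z ^ N))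
  have e : (fun n => z ^ N * (a n * z ^ n)) ∘ Equiv.subRight N = fun n => a (n - N) * z ^ n := by
    funext n
    have hz0 := ne_zero_of_norm_eq_one hz
    simp only [Function.comp_apply, Equiv.subRight_apply, zpow_sub₀ hz0]
    field_simp
  rwa [e] at h1

theorem HasLaurent.inv {a : ℤ → ℂ} {h : ℂ → ℂ} (ha : HasLaurent a h) :
    HasLaurent (fun n => a (-n)) (fun z => h z⁻¹) := by
  refine ⟨(Equiv.neg ℤ).summable_iff.2 ha.1, fun z hz => ?_⟩
  have h1 := (Equiv.neg ℤ).hasSum_iff.2 (ha.2 z⁻¹ (by simp [hz]))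
  simpa [Function.comp_def] using h1

theorem HasLaurent.conj {a : ℤ → ℂ} {h : ℂ → ℂ} (ha : HasLaurent a h) :
    HasLaurent (fun n => star (a n)) (fun z => star (h (star z))) := by
  refine ⟨by simpa using ha.1, fun z hz => ?_⟩
  simpa using (ha.2 (star z) (by simpa using hz)).star

/-! ### Products, series and exponentials in the Wiener algebra -/

/-- The convolution of two families of coefficients. -/
def convolution (a b : ℤ → ℂ) (n : ℤ) : ℂ := ∑' m, a (n - m) * b m

theorem summable_convolution {a b : ℤ → ℂ} (ha : Summable fun n => ‖a n‖)
    (hb : Summable fun n => ‖b n‖) :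
    Summable fun p : ℤ × ℤ => ‖a (p.1 - p.2) * b p.2‖ := by
  have h := ha.mul_of_nonneg hb (fun _ => norm_nonneg _) (fun _ => norm_nonneg _)
  have hinj : Function.Injective fun p : ℤ × ℤ => (p.1 - p.2, p.2) := by
    rintro ⟨_, _⟩ ⟨_, _⟩ h
    simp only [Prod.mk.injEq] at h ⊢
    omega
  simpa only [norm_mul, Function.comp_def] using h.comp_injective hinj

/-- The change of variables `(n, m) ↦ (n - m, m)`. -/
def shearEquiv : ℤ × ℤ ≃ ℤ × ℤ where
  toFun p := (p.1 - p.2, p.2)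
  invFun p := (p.1 + p.2, p.2)
  left_inv p := by simp
  right_inv p := by simp

theorem norm_convolution_le {a b : ℤ → ℂ} (ha : Summable fun n => ‖a n‖)
    (hb : Summable fun n => ‖b n‖) (n : ℤ) :
    ‖convolution a b n‖ ≤ ∑' m, ‖a (n - m) * b m‖ := by
  have h : Summable fun m => ‖a (n - m) * b m‖ := (summable_convolution ha hb).prod_factor n
  unfold convolution
  exact norm_tsum_le_tsum_norm h

theorem summable_norm_convolution {a b : ℤ → ℂ} (ha : Summable fun n => ‖a n‖)
    (hb : Summable fun n => ‖b n‖) : Summable fun n => ‖convolution a b n‖ := by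
  have h : Summable fun n => ∑' m, ‖a (n - m) * b m‖ := (summable_convolution ha hb).prod
  exact Summable.of_nonneg_of_le (fun _ => norm_nonneg _) (norm_convolution_le ha hb) h

theorem HasLaurent.mul {a b : ℤ → ℂ} {h k : ℂ → ℂ} (ha : HasLaurent a h) (hb : HasLaurent b k) :
    HasLaurent (convolution a b) (fun z => h z * k z) := by
  have hs := summable_convolution ha.1 hb.1
  refine ⟨summable_norm_convolution ha.1 hb.1, fun z hz => ?_⟩
  have hz0 := ne_zero_of_norm_eq_one hz
  have h1 : Summable fun p : ℤ × ℤ => a (p.1 - p.2) * b p.2 * z ^ p.1 := by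
    refine Summable.of_norm (hs.congr fun p => ?_)
    rw [norm_mul (_ * _), norm_zpow_of_norm_eq_one hz, mul_one]
  have e : (fun p : ℤ × ℤ => (a p.1 * z ^ p.1) * (b p.2 * z ^ p.2)) ∘ shearEquiv =
      fun p : ℤ × ℤ => a (p.1 - p.2) * b p.2 * z ^ p.1 := by
    funext p
    simp only [Function.comp_apply, shearEquiv, Equiv.coe_fn_mk, zpow_sub₀ hz0]
    field_simp
  have h2 : Summable fun p : ℤ × ℤ => (a p.1 * z ^ p.1) * (b p.2 * z ^ p.2) := by
    rw [← shearEquiv.summable_iff, e]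
    exact h1
  have h3 := shearEquiv.hasSum_iff.2 ((ha.2 z hz).mul (hb.2 z hz) h2)
  rw [e] at h3
  have h4 : ∀ n, Summable fun m => ‖a (n - m) * b m‖ := fun n => hs.prod_factor n
  have h5 : ∀ n, HasSum (fun m => a (n - m) * b m * z ^ n) (convolution a b n * z ^ n) :=
    fun n => (Summable.of_norm (h4 n)).hasSum.mul_right (z ^ n)
  exact h3.prod_fiberwise h5

theorem tsum_norm_convolution_le {a b : ℤ → ℂ} (ha : Summable fun n => ‖a n‖)
    (hb : Summable fun n => ‖b n‖) :
    ∑' n, ‖convolution a b n‖ ≤ (∑' n, ‖a n‖) * ∑' n, ‖b n‖ := by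
  have hs := summable_convolution ha hb
  have h0 : Summable fun n => ∑' m, ‖a (n - m) * b m‖ := hs.prod
  have h1 : ∑' n, ∑' m, ‖a (n - m) * b m‖ = ∑' p : ℤ × ℤ, ‖a (p.1 - p.2) * b p.2‖ :=
    hs.tsum_prod.symm
  have h2 : (∑' n, ‖a n‖) * ∑' n, ‖b n‖ = ∑' p : ℤ × ℤ, ‖a p.1‖ * ‖b p.2‖ :=
    ha.tsum_mul_tsum hb (ha.mul_of_nonneg hb (fun _ => norm_nonneg _) (fun _ => norm_nonneg _))
  refine ((summable_norm_convolution ha hb).tsum_le_tsum (norm_convolution_le ha hb) h0).trans_eq ?_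
  rw [h1, h2, ← shearEquiv.tsum_eq (fun p : ℤ × ℤ => ‖a p.1‖ * ‖b p.2‖)]
  exact tsum_congr fun p => norm_mul _ _

theorem LaurentBound.congr {S : AddSubmonoid ℤ} {M : ℝ} {h k : ℂ → ℂ} (hh : LaurentBound S M h)
    (hk : ∀ z : ℂ, ‖z‖ = 1 → h z = k z) : LaurentBound S M k := by
  obtain ⟨a, ha, h1⟩ := hh
  exact ⟨a, ha.congr hk, h1⟩

theorem HasLaurent.laurentBound {S : AddSubmonoid ℤ} {a : ℤ → ℂ} {h : ℂ → ℂ} (ha : HasLaurent a h)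
    (hS : ∀ n ∉ S, a n = 0) : LaurentBound S (∑' n, ‖a n‖) h :=
  ⟨a, ha, le_rfl, hS⟩

/-- The norm is submultiplicative, and supports add inside `S`. One calculus thus serves Laurent
series (`⊤`) and power series (`AddSubmonoid.nonneg ℤ`). -/
theorem LaurentBound.mul {S : AddSubmonoid ℤ} {M N : ℝ} {h k : ℂ → ℂ} (hh : LaurentBound S M h)
    (hk : LaurentBound S N k) : LaurentBound S (M * N) fun z => h z * k z := by
  obtain ⟨a, ha, haM, haS⟩ := hh
  obtain ⟨b, hb, hbN, hbS⟩ := hk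
  have hM : 0 ≤ M := (tsum_nonneg fun _ => norm_nonneg _).trans haM
  refine ⟨_, ha.mul hb, (tsum_norm_convolution_le ha.1 hb.1).trans
    (mul_le_mul haM hbN (tsum_nonneg fun _ => norm_nonneg _) hM), fun n hn => ?_⟩
  have : ∀ m, a (n - m) * b m = 0 := by
    intro m
    by_cases hm : m ∈ S
    · rw [haS _ fun h => hn (by simpa using S.add_mem h hm), zero_mul]
    · rw [hbS m hm, mul_zero]
  simp [convolution, this]

theorem LaurentBound.const_mul {S : AddSubmonoid ℤ} {M : ℝ} {h : ℂ → ℂ} (hh : LaurentBound S M h)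
    (c : ℂ) : LaurentBound S (‖c‖ * M) fun z => c * h z := by
  obtain ⟨a, ha, haM, haS⟩ := hh
  refine ⟨_, ha.const_mul c, ?_, fun n hn => by rw [haS n hn, mul_zero]⟩
  simp only [norm_mul]
  rw [tsum_mul_left]
  exact mul_le_mul_of_nonneg_left haM (norm_nonneg _)

theorem LaurentBound.one (S : AddSubmonoid ℤ) : LaurentBound S 1 fun _ => 1 := by
  refine ⟨Pi.single 0 1, ⟨?_, fun z _ => ?_⟩, ?_, fun n hn => ?_⟩
  · exact (hasSum_single 0 fun n hn => by simp [hn]).summable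
  · convert hasSum_single (0 : ℤ) fun n hn => ?_ using 1 <;> simp_all
  · rw [tsum_eq_single 0 fun n hn => by simp [hn]]
    simp
  · refine Pi.single_eq_of_ne ?_ _
    rintro rfl
    exact hn S.zero_mem

theorem LaurentBound.pow {S : AddSubmonoid ℤ} {M : ℝ} {h : ℂ → ℂ} (hh : LaurentBound S M h)
    (n : ℕ) : LaurentBound S (M ^ n) fun z => h z ^ n := by
  induction n with
  | zero => simpa using LaurentBound.one S
  | succ n ih => simpa only [pow_succ] using ih.mul hh

/-- Completeness of the Wiener algebra: the double family of coefficients is summable, so it may be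
summed over the functions first. Pointwise convergence suffices to identify the sum. -/
theorem LaurentBound.hasSum {S : AddSubmonoid ℤ} {M : ℕ → ℝ} {F : ℕ → ℂ → ℂ} {h : ℂ → ℂ}
    (hF : ∀ n, LaurentBound S (M n) (F n)) (hM : Summable M)
    (hh : ∀ z : ℂ, ‖z‖ = 1 → HasSum (fun n => F n z) (h z)) : LaurentBound S (∑' n, M n) h := by
  choose a ha haM haS using hF
  have hs : Summable fun p : ℕ × ℤ => ‖a p.1 p.2‖ := by
    refine (summable_prod_of_nonneg fun _ => norm_nonneg _).2 ⟨fun n => (ha n).1, ?_⟩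
    exact hM.of_nonneg_of_le (fun n => tsum_nonneg fun _ => norm_nonneg _) haM
  have hs' : Summable fun p : ℤ × ℕ => ‖a p.2 p.1‖ := hs.prod_symm
  have hs1 : Summable fun n => ∑' k, ‖a n k‖ := hs.prod
  have hs2 : Summable fun k => ∑' n, ‖a n k‖ := hs'.prod
  have hf : ∀ k, Summable fun n => ‖a n k‖ := fun k => hs'.prod_factor k
  have hle : ∀ k, ‖∑' n, a n k‖ ≤ ∑' n, ‖a n k‖ := fun k => norm_tsum_le_tsum_norm (hf k)
  have hsum : Summable fun k => ‖∑' n, a n k‖ :=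
    Summable.of_nonneg_of_le (fun _ => norm_nonneg _) hle hs2
  refine ⟨fun k => ∑' n, a n k, ⟨hsum, fun z hz => ?_⟩, ?_, fun k hk => by simp [haS _ k hk]⟩
  · have h1 : Summable fun p : ℕ × ℤ => a p.1 p.2 * z ^ p.2 := by
      refine Summable.of_norm (hs.congr fun p => ?_)
      rw [norm_mul, norm_zpow_of_norm_eq_one hz, mul_one]
    have h2 := h1.hasSum.prod_fiberwise fun n => (ha n).2 z hz
    rw [(hh z hz).unique h2]
    have h3 : HasSum (fun p : ℤ × ℕ => a p.2 p.1 * z ^ p.1)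
        (∑' p : ℕ × ℤ, a p.1 p.2 * z ^ p.2) :=
      (Equiv.prodComm ℤ ℕ).hasSum_iff.2 h1.hasSum
    have h4 : ∀ k, HasSum (fun n => a n k * z ^ k) ((∑' n, a n k) * z ^ k) :=
      fun k => (Summable.of_norm (hf k)).hasSum.mul_right (z ^ k)
    exact h3.prod_fiberwise h4
  · have h4 : ∑' k, ∑' n, ‖a n k‖ = ∑' n, ∑' k, ‖a n k‖ :=
      Summable.tsum_comm (f := fun n k => ‖a n k‖) hs
    exact ((hsum.tsum_le_tsum hle hs2).trans_eq h4).trans (hs1.tsum_le_tsum haM hM)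

theorem LaurentBound.exp {S : AddSubmonoid ℤ} {M : ℝ} {h : ℂ → ℂ} (hh : LaurentBound S M h) :
    ∃ K, LaurentBound S K fun z => Complex.exp (h z) := by
  refine ⟨_, LaurentBound.hasSum
    (fun n => (hh.pow n).const_mul ((n.factorial : ℂ)⁻¹)) ?_ fun z _ => ?_⟩
  · refine (Real.summable_pow_div_factorial M).congr fun n => ?_
    simp [div_eq_inv_mul]
  · rw [Complex.exp_eq_exp_ℂ]
    simpa [div_eq_inv_mul] using NormedSpace.expSeries_div_hasSum_exp (h z)

/-! ### Fourier coefficients -/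

theorem fact_two_pi_pos : Fact (0 < 2 * Real.pi) := ⟨Real.two_pi_pos⟩

attribute [local instance] fact_two_pi_pos

theorem coeff_eq_intervalIntegral (h : ℂ → ℂ) (k : ℤ) :
    coeff h k = (2 * Real.pi : ℂ)⁻¹ * ∫ θ in (0 : ℝ)..(2 * Real.pi),
      Complex.exp (-(k * θ * Complex.I)) * h (Complex.exp (θ * Complex.I)) := by
  rw [coeff, circleIntegral, mul_inv, mul_assoc,
    ← intervalIntegral.integral_const_mul (Complex.I)⁻¹]
  congr 1
  refine intervalIntegral.integral_congr fun θ _ => ?_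
  simp only [deriv_circleMap, circleMap_zero, Complex.ofReal_one, one_mul, smul_eq_mul]
  rw [← Complex.exp_int_mul]
  have e : Complex.exp (-(k * θ * Complex.I)) = Complex.exp (θ * Complex.I) *
      Complex.exp ((-(k + 1) : ℤ) * (θ * Complex.I)) := by
    rw [← Complex.exp_add]
    congr 1
    push_cast
    ring
  rw [e]
  field_simp

theorem coeff_eq_fourierCoeffOn (h : ℂ → ℂ) (k : ℤ) :
    coeff h k = fourierCoeffOn Real.two_pi_pos (fun θ : ℝ => h (Complex.exp (θ * Complex.I))) k := by
  rw [coeff_eq_intervalIntegral, fourierCoeffOn_eq_integral, Complex.real_smul]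
  congr 1
  · simp
  · refine intervalIntegral.integral_congr fun θ _ => ?_
    simp only [fourier_coe_apply, smul_eq_mul]
    congr 2
    have := Real.pi_ne_zero
    push_cast
    field_simp
    ring

/-- The point `exp (i x)` of the unit circle. -/
def circlePoint (x : AddCircle (2 * Real.pi)) : ℂ := fourier 1 x

theorem circlePoint_coe (θ : ℝ) :
    circlePoint (θ : AddCircle (2 * Real.pi)) = Complex.exp (θ * Complex.I) := by
  rw [circlePoint, fourier_coe_apply]
  congr 1
  have := Real.pi_ne_zero
  push_cast
  field_simp

theorem fourier_eq_zpow (n : ℤ) (x : AddCircle (2 * Real.pi)) :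
    fourier n x = circlePoint x ^ n := by
  induction x using QuotientAddGroup.induction_on with
  | H θ =>
    refine (fourier_coe_apply (x := θ)).trans ?_
    refine Eq.trans ?_ (congrArg (· ^ n) (circlePoint_coe θ)).symm
    rw [← Complex.exp_int_mul]
    congr 1
    have := Real.pi_ne_zero
    push_cast
    field_simp

theorem continuous_circlePoint : Continuous circlePoint := (fourier 1).continuous

theorem norm_circlePoint (x : AddCircle (2 * Real.pi)) : ‖circlePoint x‖ = 1 := by
  rw [circlePoint, fourier_apply]
  exact Circle.norm_coe _

theorem coeff_eq_fourierCoeff (h : ℂ → ℂ) (k : ℤ) :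
    coeff h k = fourierCoeff (fun x : AddCircle (2 * Real.pi) => h (circlePoint x)) k := by
  rw [coeff_eq_intervalIntegral, fourierCoeff_eq_intervalIntegral _ _ 0, zero_add,
    Complex.real_smul]
  congr 1
  · simp
  · refine intervalIntegral.integral_congr fun θ _ => ?_
    simp only [fourier_eq_zpow, smul_eq_mul, circlePoint_coe, ← Complex.exp_int_mul]
    congr 2
    push_cast
    ring

theorem exists_eq_circlePoint {z : ℂ} (hz : ‖z‖ = 1) :
    ∃ x : AddCircle (2 * Real.pi), z = circlePoint x := by
  refine ⟨(z.arg : ℝ), ?_⟩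
  rw [circlePoint_coe]
  simpa [hz] using (Complex.norm_mul_exp_arg_mul_I z).symm

theorem HasLaurent.coeff_eq {a : ℤ → ℂ} {h : ℂ → ℂ} (ha : HasLaurent a h) (k : ℤ) :
    coeff h k = a k := by
  have hs : Summable fun n => a n • (fourier n : C(AddCircle (2 * Real.pi), ℂ)) := by
    refine Summable.of_norm (ha.1.congr fun n => ?_)
    rw [norm_smul, fourier_norm, mul_one]
  let F : C(AddCircle (2 * Real.pi), ℂ) := ∑' n, a n • fourier n
  have hF : (fun x : AddCircle (2 * Real.pi) => h (circlePoint x)) = F := by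
    funext x
    have h1 : HasSum (fun n => a n * fourier n x) (F x) :=
      (ContinuousMap.evalCLM ℂ x).hasSum hs.hasSum
    simp only [fourier_eq_zpow] at h1
    exact (ha.2 _ (norm_circlePoint x)).unique h1
  -- Taking the `k`-th Fourier coefficient is continuous in the uniform norm, as an `L²` inner
  -- product, so it passes through the series.
  let L : C(AddCircle (2 * Real.pi), ℂ) →L[ℂ] ℂ :=
    (innerSL ℂ (fourierLp 2 k)).comp (ContinuousMap.toLp 2 AddCircle.haarAddCircle ℂ)
  have hL : ∀ f, L f = fourierCoeff f k := by
    intro f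
    rw [← fourierCoeff_toLp, ← fourierBasis_repr, fourierBasis.repr_apply_apply, coe_fourierBasis]
    rfl
  have h2 := L.hasSum hs.hasSum
  rw [coeff_eq_fourierCoeff, hF, ← hL]
  have e : (fun n => L (a n • fourier n)) = fun n => if n = k then a k else 0 := by
    funext n
    rw [map_smul, hL, fourierCoeff_fourier, smul_eq_mul, Pi.single_apply]
    rcases eq_or_ne n k with rfl | h1
    · simp
    · simp [h1, h1.symm]
  rw [e] at h2
  exact h2.unique (hasSum_ite_eq k _)

theorem HasLaurent.unique {a b : ℤ → ℂ} {h : ℂ → ℂ} (ha : HasLaurent a h) (hb : HasLaurent b h) :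
    a = b := by
  funext k
  rw [← ha.coeff_eq, hb.coeff_eq]

/-- A continuous function with summable Fourier coefficients is the sum of its Fourier series. -/
theorem hasLaurent_coeff {h : ℂ → ℂ} (hc : ContinuousOn h (Metric.sphere 0 1))
    (hs : Summable fun k => ‖coeff h k‖) : HasLaurent (coeff h) h := by
  refine ⟨hs, fun z hz => ?_⟩
  obtain ⟨x, rfl⟩ := exists_eq_circlePoint hz
  let F : C(AddCircle (2 * Real.pi), ℂ) :=
    ⟨fun x => h (circlePoint x), hc.comp_continuous continuous_circlePoint
      fun x => by simp [norm_circlePoint]⟩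
  have e : ∀ k, coeff h k = fourierCoeff F k := fun k => coeff_eq_fourierCoeff h k
  have h1 : Summable (fourierCoeff F) := (Summable.of_norm hs).congr e
  have h2 := has_pointwise_sum_fourier_series_of_summable h1 x
  simp only [smul_eq_mul, ← e, fourier_eq_zpow] at h2
  exact h2

theorem HasLaurent.ofReal_re_coeff_eq {a : ℤ → ℂ} {h : ℂ → ℂ} (ha : HasLaurent a h)
    (hr : ∀ z : ℂ, ‖z‖ = 1 → star (h (star z)) = h z) (k : ℤ) : ((a k).re : ℂ) = a k :=
  Complex.conj_eq_iff_re.1 (congrFun ((ha.conj.congr hr).unique ha) k)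

/-! ### Logarithms of absolutely convergent Laurent series -/

theorem LaurentBound.mono {S : AddSubmonoid ℤ} {M N : ℝ} {h : ℂ → ℂ} (hh : LaurentBound S M h)
    (hMN : M ≤ N) : LaurentBound S N h := by
  obtain ⟨a, ha, h1, h2⟩ := hh
  exact ⟨a, ha, h1.trans hMN, h2⟩

/-- Near `θ` continuity keeps the imaginary part of `w x - w θ` below `π` in absolute value, so `w`
is `w θ` plus the principal logarithm of `g x / g θ`. -/
theorem hasDerivAt_of_exp_eq {w g : ℝ → ℂ} {g' : ℂ} {θ : ℝ} (hw : ContinuousAt w θ)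
    (hg : HasDerivAt g g' θ) (he : ∀ x, Complex.exp (w x) = g x) :
    HasDerivAt w (g' / g θ) θ := by
  have h0 : g θ ≠ 0 := by
    rw [← he]
    exact Complex.exp_ne_zero _
  have h1 : HasDerivAt (fun x => w θ + Complex.log (g x / g θ)) (g' / g θ) θ := by
    have h2 := (hg.div_const (g θ)).clog_real (by rw [div_self h0]; exact Complex.one_mem_slitPlane)
    rw [div_self h0, div_one] at h2
    exact h2.const_add (w θ)
  refine h1.congr_of_eventuallyEq ?_
  have h3 : ContinuousAt (fun x => |(w x - w θ).im|) θ :=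
    (Complex.continuous_im.continuousAt.comp (hw.sub continuousAt_const)).abs
  have h4 : ∀ᶠ x in nhds θ, |(w x - w θ).im| < Real.pi :=
    h3.eventually_lt continuousAt_const (by simp [Real.pi_pos])
  filter_upwards [h4] with x hx
  rw [← he, ← he, ← Complex.exp_sub, Complex.log_exp (abs_lt.1 hx).1 (abs_lt.1 hx).2.le]
  ring

theorem norm_coeff_le {h : ℂ → ℂ} {A : ℝ} (hA : ∀ z : ℂ, ‖z‖ = 1 → ‖h z‖ ≤ A) (k : ℤ) :
    ‖coeff h k‖ ≤ A := by
  rw [coeff_eq_intervalIntegral, norm_mul]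
  have h1 := intervalIntegral.norm_integral_le_of_norm_le_const (a := 0) (b := 2 * Real.pi)
    (f := fun θ : ℝ => Complex.exp (-(k * θ * Complex.I)) * h (Complex.exp (θ * Complex.I)))
    (C := A) fun θ _ => by
      rw [norm_mul]
      have : Complex.exp (-(k * θ * Complex.I)) = Complex.exp (((-(k * θ) : ℝ) : ℂ) * Complex.I) := by
        push_cast
        ring_nf
      rw [this, norm_exp_mul_I, one_mul]
      exact hA _ (norm_exp_mul_I θ)
  have hpi := Real.two_pi_pos
  rw [sub_zero, abs_of_pos hpi] at h1
  calc _ ≤ ‖(2 * Real.pi : ℂ)⁻¹‖ * (A * (2 * Real.pi)) :=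
        mul_le_mul_of_nonneg_left h1 (norm_nonneg _)
    _ = A := by
      have : ‖(2 * Real.pi : ℂ)⁻¹‖ = (2 * Real.pi)⁻¹ := by
        rw [norm_inv]
        norm_cast
        rw [Real.norm_of_nonneg hpi.le]
      rw [this]
      field_simp

theorem continuous_comp_exp {h : ℂ → ℂ} (hc : ContinuousOn h (Metric.sphere 0 1)) :
    Continuous fun θ : ℝ => h (Complex.exp (θ * Complex.I)) :=
  hc.comp_continuous (by fun_prop) fun θ => by simp

/-- Half of `1 + ∑ 1 / k²`. -/
def derivConstant : ℝ := (1 + ∑' k : ℤ, 1 / (k : ℝ) ^ 2) / 2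

theorem derivConstant_nonneg : 0 ≤ derivConstant := by
  have : 0 ≤ ∑' k : ℤ, 1 / (k : ℝ) ^ 2 := tsum_nonneg fun k => by positivity
  unfold derivConstant
  positivity

/-- Continuously differentiable functions have absolutely convergent Fourier series. -/
theorem laurentBound_of_hasDerivAt {h h' : ℂ → ℂ} {A B : ℝ} (hB : 0 < B)
    (hc : ContinuousOn h (Metric.sphere 0 1)) (hc' : ContinuousOn h' (Metric.sphere 0 1))
    (hd : ∀ θ : ℝ, HasDerivAt (fun θ : ℝ => h (Complex.exp (θ * Complex.I)))
      (h' (Complex.exp (θ * Complex.I))) θ)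
    (hhA : ∀ z : ℂ, ‖z‖ = 1 → ‖h z‖ ≤ A) (hhB : ∀ z : ℂ, ‖z‖ = 1 → ‖h' z‖ ≤ B) :
    LaurentBound ⊤ (A + derivConstant * B) h := by
  have hcoeff : ∀ k : ℤ, k ≠ 0 → ‖coeff h k‖ = ‖coeff h' k‖ / |(k : ℝ)| := by
    intro k hk
    rw [coeff_eq_fourierCoeffOn, coeff_eq_fourierCoeffOn,
      fourierCoeffOn_of_hasDerivAt Real.two_pi_pos hk (fun θ _ => hd θ)
        ((continuous_comp_exp hc').intervalIntegrable _ _)]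
    have hk' : (k : ℂ) ≠ 0 := by exact_mod_cast hk
    have hpi : (Real.pi : ℂ) ≠ 0 := by exact_mod_cast Real.pi_ne_zero
    -- The boundary term of the integration by parts vanishes by periodicity.
    have e : ∀ u v : ℂ, 1 / (-2 * Real.pi * Complex.I * k) *
        (u * (h (Complex.exp ((2 * Real.pi : ℝ) * Complex.I)) -
          h (Complex.exp ((0 : ℝ) * Complex.I))) - ((2 * Real.pi : ℝ) - (0 : ℝ)) * v) =
        v / (Complex.I * k) := by
      intro u v
      have h1 : Complex.exp ((2 * Real.pi : ℝ) * Complex.I) = 1 := by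
        push_cast
        exact Complex.exp_two_pi_mul_I
      rw [h1]
      push_cast
      rw [zero_mul, Complex.exp_zero, sub_self, mul_zero, zero_sub, sub_zero]
      field_simp [Complex.I_ne_zero]
    rw [e, norm_div, norm_mul, Complex.norm_I, one_mul, Complex.norm_intCast]
  have hL2 : MemLp (fun θ : ℝ => h' (Complex.exp (θ * Complex.I))) 2
      (volume.restrict (Set.Ioc 0 (2 * Real.pi))) :=
    MemLp.of_bound (continuous_comp_exp hc').aestronglyMeasurable B
      (.of_forall fun θ => hhB _ (norm_exp_mul_I θ))
  have hpars := hasSum_sq_fourierCoeffOn Real.two_pi_pos hL2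
  simp only [← coeff_eq_fourierCoeffOn] at hpars
  -- Parseval, with the mean square of `h'` bounded by its sup norm.
  have hsq : ∑' k, ‖coeff h' k‖ ^ 2 ≤ B ^ 2 := by
    rw [hpars.tsum_eq, sub_zero, smul_eq_mul]
    have h1 : ∫ θ in (0 : ℝ)..(2 * Real.pi), ‖h' (Complex.exp (θ * Complex.I))‖ ^ 2 ≤
        ∫ _ in (0 : ℝ)..(2 * Real.pi), B ^ 2 := by
      refine intervalIntegral.integral_mono_on Real.two_pi_pos.le
        (((continuous_comp_exp hc').norm.pow 2).intervalIntegrable _ _) (by simp) fun θ _ => ?_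
      exact pow_le_pow_left₀ (norm_nonneg _) (hhB _ (norm_exp_mul_I θ)) 2
    rw [intervalIntegral.integral_const, sub_zero, smul_eq_mul] at h1
    rw [inv_mul_le_iff₀ Real.two_pi_pos]
    exact h1
  have hinv : Summable fun k : ℤ => 1 / (k : ℝ) ^ 2 :=
    Real.summable_one_div_int_pow.2 one_lt_two
  -- The inequality `y / x ≤ (B⁻¹ y² + B / x²) / 2`, weighted so that both sums are linear in `B`;
  -- this fixes `derivConstant`. At `k = 0` the value `1 / 0 ^ 2` is `0`, and `A` bounds the
  -- coefficient.
  have hbound : ∀ k, ‖coeff h k‖ ≤ (if k = 0 then A else 0) +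
      (B⁻¹ * ‖coeff h' k‖ ^ 2 + B * (1 / (k : ℝ) ^ 2)) / 2 := by
    intro k
    split_ifs with hk
    · have h1 := norm_coeff_le hhA k
      have h2 : 0 ≤ (B⁻¹ * ‖coeff h' k‖ ^ 2 + B * (1 / (k : ℝ) ^ 2)) / 2 := by positivity
      linarith
    · rw [hcoeff k hk, zero_add, ← sq_abs (k : ℝ)]
      have hk' : 0 < |(k : ℝ)| := abs_pos.2 (by exact_mod_cast hk)
      generalize |(k : ℝ)| = x at *
      generalize ‖coeff h' k‖ = y
      have h1 : (B⁻¹ * y ^ 2 + B * (1 / x ^ 2)) / 2 - y / x = B⁻¹ * (y - B / x) ^ 2 / 2 := by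
        field_simp
        ring
      have h2 : 0 ≤ B⁻¹ * (y - B / x) ^ 2 / 2 := by positivity
      linarith
  have hsum := (hasSum_ite_eq (0 : ℤ) A).add
    (((hpars.summable.hasSum.mul_left B⁻¹).add (hinv.hasSum.mul_left B)).div_const 2)
  have hs : Summable fun k => ‖coeff h k‖ :=
    hsum.summable.of_nonneg_of_le (fun _ => norm_nonneg _) hbound
  refine ⟨coeff h, hasLaurent_coeff hc hs, ?_, fun n hn => absurd (AddSubmonoid.mem_top n) hn⟩
  refine (hs.tsum_le_tsum hbound hsum.summable).trans ?_
  rw [hsum.tsum_eq]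
  have h1 : B⁻¹ * ∑' k, ‖coeff h' k‖ ^ 2 ≤ B := by
    rw [inv_mul_le_iff₀ hB, ← sq]
    exact hsq
  unfold derivConstant
  linarith

theorem hasDerivAt_trigPolynomial (s : Finset ℤ) (a : ℤ → ℂ) (θ : ℝ) :
    HasDerivAt (fun θ : ℝ => ∑ n ∈ s, a n * Complex.exp (θ * Complex.I) ^ n)
      (∑ n ∈ s, a n * n * Complex.I * Complex.exp (θ * Complex.I) ^ n) θ := by
  refine HasDerivAt.fun_sum fun n _ => ?_
  have h1 : HasDerivAt (fun θ : ℝ => Complex.exp (θ * (n * Complex.I)))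
      (Complex.exp (θ * (n * Complex.I)) * (n * Complex.I)) θ := by
    have := ((hasDerivAt_id θ).ofReal_comp.mul_const (n * Complex.I)).cexp
    simpa using this
  have e : ∀ θ : ℝ, Complex.exp (θ * (n * Complex.I)) = Complex.exp (θ * Complex.I) ^ n := by
    intro θ
    rw [← Complex.exp_int_mul]
    ring_nf
  simp only [e] at h1
  refine (h1.const_mul (a n)).congr_deriv ?_
  ring

theorem continuousOn_trigPolynomial (s : Finset ℤ) (a : ℤ → ℂ) :
    ContinuousOn (fun z : ℂ => ∑ n ∈ s, a n * z ^ n) (Metric.sphere 0 1) := by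
  refine continuousOn_finsetSum s fun n _ => continuousOn_const.mul fun z hz => ?_
  exact (continuousAt_zpow₀ z n
    (.inl (ne_zero_of_norm_eq_one (by simpa using hz)))).continuousWithinAt

theorem hasSum_ite_mem {E : Type*} [NormedAddCommGroup E] (s : Finset ℤ) (c : ℤ → E) :
    HasSum (fun n => if n ∈ s then c n else 0) (∑ n ∈ s, c n) := by
  have h : HasSum (fun n => if n ∈ s then c n else 0) (∑ n ∈ s, if n ∈ s then c n else 0) :=
    hasSum_sum_of_ne_finset_zero fun n hn => if_neg hn
  rwa [Finset.sum_congr rfl fun n hn => if_pos hn] at h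

/-- Truncate the series: the error is the tail of a summable family, hence small in the Wiener norm
and not only uniformly. -/
theorem HasLaurent.exists_trigPolynomial {a : ℤ → ℂ} {h : ℂ → ℂ} (ha : HasLaurent a h) {ε : ℝ}
    (hε : 0 < ε) :
    ∃ s : Finset ℤ, LaurentBound ⊤ ε fun z => h z - ∑ n ∈ s, a n * z ^ n := by
  obtain ⟨s, hs⟩ := (ha.1.hasSum.eventually (lt_mem_nhds (sub_lt_self _ hε))).exists
  refine ⟨s, fun n => a n - if n ∈ s then a n else 0, ⟨?_, fun z hz => ?_⟩, ?_,
    fun n hn => absurd (AddSubmonoid.mem_top n) hn⟩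
  · refine ha.1.of_nonneg_of_le (fun _ => norm_nonneg _) fun n => ?_
    dsimp only
    split_ifs <;> simp
  · have h1 := hasSum_ite_mem s fun n => a n * z ^ n
    simp only [← ite_zero_mul] at h1
    simpa only [sub_mul] using (ha.2 z hz).sub h1
  · have h1 := hasSum_ite_mem s fun n => ‖a n‖
    have e : ∀ n, ‖a n - if n ∈ s then a n else 0‖ = ‖a n‖ - if n ∈ s then ‖a n‖ else 0 := by
      intro n
      split_ifs <;> simp
    simp only [e]
    rw [(ha.1.hasSum.sub h1).tsum_eq]
    linarith

/-- A continuous logarithm of an absolutely convergent Laurent series is an absolutely convergent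
Laurent series. -/
theorem HasLaurent.exists_log {a : ℤ → ℂ} {f V : ℂ → ℂ} (ha : HasLaurent a f)
    (hV : ContinuousOn V (Metric.sphere 0 1))
    (hexp : ∀ z : ℂ, ‖z‖ = 1 → Complex.exp (V z) = f z) : ∃ v, HasLaurent v V := by
  have hf := ha.continuousOn
  obtain ⟨δ, hδ, hfδ⟩ : ∃ δ > 0, ∀ z : ℂ, ‖z‖ = 1 → δ ≤ ‖f z‖ := by
    obtain ⟨x, hx, hmin⟩ := (isCompact_sphere (0 : ℂ) 1).exists_isMinOn
      (NormedSpace.sphere_nonempty.2 zero_le_one) hf.norm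
    refine ⟨‖f x‖, ?_, fun z hz => hmin (by simpa using hz)⟩
    rw [← hexp x (by simpa using hx)]
    exact norm_pos_iff.2 (Complex.exp_ne_zero _)
  -- With error `δ / 4` one has `|p| ≥ 3δ / 4`, so `r = 4 / (3δ)` bounds `1 / |p|` and the ratio `(δ
  -- / 4) r` is `1 / 3`.
  obtain ⟨s, hs⟩ := ha.exists_trigPolynomial (ε := δ / 4) (by positivity)
  set p : ℂ → ℂ := fun z => ∑ n ∈ s, a n * z ^ n with hp
  set p' : ℂ → ℂ := fun z => ∑ n ∈ s, a n * n * Complex.I * z ^ n with hp'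
  have hpc : ContinuousOn p (Metric.sphere 0 1) := continuousOn_trigPolynomial s a
  have hpc' : ContinuousOn p' (Metric.sphere 0 1) := continuousOn_trigPolynomial s _
  have hpd : ∀ θ : ℝ, HasDerivAt (fun θ : ℝ => p (Complex.exp (θ * Complex.I)))
      (p' (Complex.exp (θ * Complex.I))) θ := hasDerivAt_trigPolynomial s a
  obtain ⟨D, hD, hpD⟩ : ∃ D > 0, ∀ z : ℂ, ‖z‖ = 1 → ‖p' z‖ ≤ D := by
    obtain ⟨C, hC⟩ := (isCompact_sphere (0 : ℂ) 1).exists_bound_of_continuousOn hpc'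
    exact ⟨max C 1, by positivity, fun z hz => (hC z (by simpa using hz)).trans (le_max_left _ _)⟩
  have hfp : ∀ z : ℂ, ‖z‖ = 1 → ‖f z - p z‖ ≤ δ / 4 := by
    intro z hz
    obtain ⟨b, hb, hb1, -⟩ := hs
    exact (hb.norm_le hz).trans hb1
  set r : ℝ := 4 / (3 * δ) with hr
  have hr0 : 0 < r := by positivity
  have hp3 : ∀ z : ℂ, ‖z‖ = 1 → r⁻¹ ≤ ‖p z‖ := by
    intro z hz
    have h1 := norm_sub_norm_le (f z) (f z - p z)
    rw [sub_sub_cancel] at h1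
    have h2 : r⁻¹ = 3 * δ / 4 := by rw [hr, inv_div]
    linarith [hfp z hz, hfδ z hz]
  have hp0 : ∀ z : ℂ, ‖z‖ = 1 → p z ≠ 0 := fun z hz =>
    norm_pos_iff.1 ((inv_pos.2 hr0).trans_le (hp3 z hz))
  have hpr : ∀ z : ℂ, ‖z‖ = 1 → ‖(p z)⁻¹‖ ≤ r := fun z hz => by
    rw [norm_inv]
    exact inv_le_of_inv_le₀ hr0 (hp3 z hz)
  have hq : ∀ z : ℂ, ‖z‖ = 1 → ‖(f z - p z) * (p z)⁻¹‖ < 1 := fun z hz => by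
    rw [norm_mul]
    calc _ ≤ δ / 4 * r := mul_le_mul (hfp z hz) (hpr z hz) (norm_nonneg _) (by positivity)
      _ < 1 := by rw [hr]; field_simp; norm_num
  have hpinv : ContinuousOn (fun z => (p z)⁻¹) (Metric.sphere 0 1) :=
    hpc.inv₀ fun z hz => hp0 z (by simpa using hz)
  -- powers of `1 / p`
  have hpow : ∀ n : ℕ, LaurentBound ⊤ (r ^ n + derivConstant * ((n + 1) * D * r ^ (n + 1)))
      fun z => (p z)⁻¹ ^ n := by
    intro n
    -- The Wiener norm of `p⁻ⁿ` is controlled through its derivative and grows only like `n rⁿ`,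
    -- where powers of the norm of `p⁻¹` could grow faster. The factor `n + 1` instead of `n` keeps
    -- the derivative bound positive at `n = 0`.
    refine laurentBound_of_hasDerivAt
      (h' := fun z => n * (p z)⁻¹ ^ (n - 1) * (-p' z / p z ^ 2)) (by positivity)
      (hpinv.pow n) ?_ (fun θ => ?_) (fun z hz => ?_) (fun z hz => ?_)
    · refine (continuousOn_const.mul (hpinv.pow _)).mul (hpc'.neg.div (hpc.pow 2) fun z hz => ?_)
      exact pow_ne_zero 2 (hp0 z (by simpa using hz))
    · exact ((hpd θ).fun_inv (hp0 _ (norm_exp_mul_I θ))).fun_pow n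
    · rw [norm_pow]
      exact pow_le_pow_left₀ (norm_nonneg _) (hpr z hz) n
    · rcases n with _ | n
      · simp
        positivity
      · have e : -p' z / p z ^ 2 = -p' z * (p z)⁻¹ ^ 2 := by rw [div_eq_mul_inv, inv_pow]
        rw [e, norm_mul, norm_mul, norm_mul, norm_neg, norm_pow, norm_pow, Complex.norm_natCast]
        have h1 := hpr z hz
        have h2 := hpD z hz
        push_cast
        calc ((n : ℝ) + 1) * ‖(p z)⁻¹‖ ^ n * (‖p' z‖ * ‖(p z)⁻¹‖ ^ 2)
            ≤ (n + 1) * r ^ n * (D * r ^ 2) := by gcongr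
          _ = (n + 1) * D * r ^ (n + 1 + 1) := by ring
          _ ≤ (n + 1 + 1) * D * r ^ (n + 1 + 1) := by gcongr; linarith
  -- the logarithm of `f / p`
  set W : ℂ → ℂ := fun z => Complex.log (1 + (f z - p z) * (p z)⁻¹) with hW
  have hWL : ∃ K, LaurentBound ⊤ K W := by
    -- The `n = 0` term is zero since `(-1) / 0 = 0`. The coefficient `1 / n` absorbs the growth `n
    -- + 1`, leaving a geometric series of ratio `1 / 3`.
    have hterm : ∀ n : ℕ, LaurentBound ⊤ ((1 + derivConstant * (2 * D * r)) * (1 / 3) ^ n)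
        fun z => (-1) ^ (n + 1) / (n : ℂ) * ((f z - p z) ^ n * (p z)⁻¹ ^ n) := by
      intro n
      refine (((hs.pow n).mul (hpow n)).const_mul _).mono ?_
      rw [norm_div, norm_pow, norm_neg, norm_one, one_pow, Complex.norm_natCast]
      have h1 : (1 / n : ℝ) ≤ 1 := by
        rcases n with _ | n
        · simp
        · rw [div_le_one (by positivity)]
          push_cast
          linarith [n.cast_nonneg (α := ℝ)]
      have h2 : (1 / n : ℝ) * (n + 1) ≤ 2 := by
        rcases n with _ | n
        · simp
        · rw [one_div, inv_mul_le_iff₀ (by positivity)]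
          push_cast
          linarith [n.cast_nonneg (α := ℝ)]
      have h3 : δ / 4 * r = 1 / 3 := by rw [hr]; field_simp
      have hK := derivConstant_nonneg
      calc 1 / (n : ℝ) * ((δ / 4) ^ n * (r ^ n + derivConstant * ((n + 1) * D * r ^ (n + 1))))
          = (1 / n + derivConstant * ((1 / n * (n + 1)) * D * r)) * (δ / 4 * r) ^ n := by
            rw [mul_pow]; ring
        _ ≤ (1 + derivConstant * (2 * D * r)) * (1 / 3) ^ n := by rw [h3]; gcongr
    refine ⟨_, LaurentBound.hasSum hterm
      ((summable_geometric_of_lt_one (by norm_num) (by norm_num)).mul_left _) fun z hz => ?_⟩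
    convert Complex.hasSum_taylorSeries_log (hq z hz) using 2 with n
    rw [mul_pow]
    ring
  -- the logarithm of `p`
  have hWc : ContinuousOn W (Metric.sphere 0 1) := by
    refine (continuousOn_const.add ((hf.sub hpc).mul hpinv)).clog fun z hz => ?_
    exact Complex.mem_slitPlane_of_norm_lt_one (hq z (by simpa using hz))
  have hU : ContinuousOn (fun z => V z - W z) (Metric.sphere 0 1) := hV.sub hWc
  have hUexp : ∀ z : ℂ, ‖z‖ = 1 → Complex.exp (V z - W z) = p z := by
    intro z hz
    have h0 := hp0 z hz
    have e : 1 + (f z - p z) * (p z)⁻¹ = f z / p z := by field_simp; ring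
    have hf0 : f z ≠ 0 := by
      rw [← hexp z hz]
      exact Complex.exp_ne_zero _
    rw [Complex.exp_sub, hexp z hz, hW]
    simp only [e]
    rw [Complex.exp_log (div_ne_zero hf0 h0)]
    field_simp
  obtain ⟨A, hA⟩ := (isCompact_sphere (0 : ℂ) 1).exists_bound_of_continuousOn hU
  -- `V - W` is a continuous logarithm of `p`, so along the circle its derivative is `p' / p`.
  have hUL : LaurentBound ⊤ (A + derivConstant * (D * r)) fun z => V z - W z := by
    refine laurentBound_of_hasDerivAt (h' := fun z => p' z * (p z)⁻¹) (by positivity) hU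
      (hpc'.mul hpinv) (fun θ => ?_) (fun z hz => hA z (by simpa using hz)) fun z hz => ?_
    · have := hasDerivAt_of_exp_eq (continuous_comp_exp hU).continuousAt (hpd θ)
        fun x => hUexp _ (norm_exp_mul_I x)
      rwa [div_eq_mul_inv] at this
    · rw [norm_mul]
      exact mul_le_mul (hpD z hz) (hpr z hz) (norm_nonneg _) hD.le
  obtain ⟨K, w, hw, -⟩ := hWL
  obtain ⟨u, hu, -⟩ := hUL
  exact ⟨_, (hu.add hw).congr fun z _ => sub_add_cancel _ _⟩

/-! ### The symbol and its continuous logarithms -/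

theorem hasLaurent_symbol {t : ℤ → ℝ} (ht : Summable fun n => |t n|) :
    HasLaurent (fun n => (t n : ℂ)) (symbol t) := by
  have h1 : Summable fun n => ‖(t n : ℂ)‖ := by simpa using ht
  refine ⟨h1, fun z hz => (Summable.of_norm (h1.congr fun n => ?_)).hasSum⟩
  rw [norm_mul, norm_zpow_of_norm_eq_one hz, mul_one]

theorem star_symbol_star (t : ℤ → ℝ) (z : ℂ) : star (symbol t (star z)) = symbol t z := by
  rw [symbol, tsum_star, symbol]
  simp

/-- Subtracting `ω θ` from the argument `φ` removes its growth over a turn, so `log |f| + i (φ - ω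
θ)` has equal endpoint values and descends to the circle. -/
theorem exists_isContinuousLog {t : ℤ → ℝ} (ht : Summable fun n => |t n|) (hgap : IsGapped t)
    {ω : ℤ} (hω : HasWindingNumber (symbol t) ω) : ∃ V, IsContinuousLog t ω V := by
  obtain ⟨φ, hφc, hφ, hφω⟩ := hω
  have hpi := Real.two_pi_pos
  let G : ℝ → ℂ := fun θ => (Real.log ‖symbol t (Complex.exp (θ * Complex.I))‖ : ℂ) +
    (φ θ - ω * θ) * Complex.I
  have hsymb := continuous_comp_exp (hasLaurent_symbol ht).continuousOn
  have hGc : ContinuousOn G (Set.Icc 0 (2 * Real.pi)) := by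
    refine ContinuousOn.add ?_ ?_
    · refine (Complex.continuous_ofReal.comp (hsymb.norm.log fun θ => ?_)).continuousOn
      exact norm_ne_zero_iff.2 (hgap _ (norm_exp_mul_I θ))
    · exact ((Complex.continuous_ofReal.comp_continuousOn hφc).sub (by fun_prop)).mul
        continuousOn_const
  have hG : G 0 = G (2 * Real.pi) := by
    have h1 : Complex.exp ((2 * Real.pi : ℝ) * Complex.I) = 1 := by
      push_cast
      exact Complex.exp_two_pi_mul_I
    have h2 : (φ (2 * Real.pi) : ℂ) - φ 0 = 2 * Real.pi * ω := by exact_mod_cast hφω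
    simp only [G, h1]
    push_cast
    rw [zero_mul, Complex.exp_zero]
    linear_combination -Complex.I * h2
  have hL : Continuous (AddCircle.liftIco (2 * Real.pi) 0 G) :=
    AddCircle.liftIco_zero_continuous hG hGc
  refine ⟨fun z => AddCircle.liftIco (2 * Real.pi) 0 G ((z.arg : ℝ) : AddCircle (2 * Real.pi)),
    fun z hz => ?_, fun z hz => ?_⟩
  · have hz0 : z ≠ 0 := ne_zero_of_norm_eq_one (by simpa using hz)
    exact (hL.continuousAt.comp (Complex.continuousAt_arg_coe_angle hz0)).continuousWithinAt
  · obtain ⟨θ, hθ, hθz⟩ : ∃ θ ∈ Set.Ico (0 : ℝ) (0 + 2 * Real.pi),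
        (θ : AddCircle (2 * Real.pi)) = ((z.arg : ℝ) : AddCircle (2 * Real.pi)) := by
      have := AddCircle.coe_image_Ico_eq (2 * Real.pi) 0
      have h1 : ((z.arg : ℝ) : AddCircle (2 * Real.pi)) ∈
        ((↑) : ℝ → AddCircle (2 * Real.pi)) '' Set.Ico 0 (0 + 2 * Real.pi) := by
        rw [this]; trivial
      exact h1
    have hzθ : z = Complex.exp (θ * Complex.I) := by
      rw [← circlePoint_coe, hθz, circlePoint_coe]
      simpa [hz] using (Complex.norm_mul_exp_arg_mul_I z).symm
    have hf0 := hgap z hz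
    have hφθ := hφ θ ⟨hθ.1, by linarith [hθ.2]⟩
    dsimp only
    rw [← hθz, AddCircle.liftIco_coe_apply hθ]
    simp only [G]
    rw [← hzθ] at hφθ ⊢
    rw [Complex.exp_add, ← Complex.ofReal_exp, Real.exp_log (norm_pos_iff.2 hf0), sub_mul,
      Complex.exp_sub, ← mul_div_assoc, ← hφθ, mul_assoc, Complex.exp_int_mul, ← hzθ, zpow_neg]
    field_simp

theorem IsContinuousLog.hasLaurent {t : ℤ → ℝ} (ht : Summable fun n => |t n|) {ω : ℤ} {V : ℂ → ℂ}
    (hV : IsContinuousLog t ω V) : HasLaurent (coeff V) V := by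
  obtain ⟨v, hv⟩ := ((hasLaurent_symbol ht).zpow_mul (-ω)).exists_log hV.1 hV.2
  rwa [show coeff V = v from funext hv.coeff_eq]

theorem IsContinuousLog.symbol_eq {t : ℤ → ℝ} {ω : ℤ} {V : ℂ → ℂ}
    (hV : IsContinuousLog t ω V) {z : ℂ} (hz : ‖z‖ = 1) :
    symbol t z = z ^ ω * Complex.exp (V z) := by
  have hz0 := ne_zero_of_norm_eq_one hz
  rw [hV.2 z hz, zpow_neg]
  field_simp

/-- A continuous logarithm of a constant has zero derivative along the circle. -/
theorem exists_eq_const_of_exp_eq_one {D : ℂ → ℂ} (hc : ContinuousOn D (Metric.sphere 0 1))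
    (hD : ∀ z : ℂ, ‖z‖ = 1 → Complex.exp (D z) = 1) : ∃ d, ∀ z : ℂ, ‖z‖ = 1 → D z = d := by
  have h1 : ∀ θ : ℝ, HasDerivAt (fun θ : ℝ => D (Complex.exp (θ * Complex.I))) 0 θ := by
    intro θ
    have := hasDerivAt_of_exp_eq (continuous_comp_exp hc).continuousAt (hasDerivAt_const θ (1 : ℂ))
      fun x => hD _ (norm_exp_mul_I x)
    rwa [zero_div] at this
  refine ⟨D (Complex.exp ((0 : ℝ) * Complex.I)), fun z hz => ?_⟩
  have h2 := is_const_of_deriv_eq_zero (fun θ => (h1 θ).differentiableAt)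
    (fun θ => (h1 θ).deriv) z.arg 0
  rw [← h2]
  congr 1
  simpa [hz] using (Complex.norm_mul_exp_arg_mul_I z).symm

theorem hasLaurent_const (c : ℂ) : HasLaurent (fun n => if n = 0 then c else 0) fun _ => c := by
  refine ⟨?_, fun z _ => ?_⟩
  · refine summable_of_ne_finset_zero (s := {0}) fun n hn => ?_
    dsimp only
    rw [if_neg (by simpa using hn), norm_zero]
  · convert hasSum_ite_eq (0 : ℤ) c using 2 with n
    dsimp only
    split_ifs with hn
    · rw [hn, zpow_zero, mul_one]
    · rw [zero_mul]

/-- Since `t` is real, `star (V (star z))` is another continuous logarithm of the same function. It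
differs from `V` by a constant, which affects only the coefficient at `0`; that one need not be
real. -/
theorem IsContinuousLog.star_coeff {t : ℤ → ℝ} (ht : Summable fun n => |t n|) {ω : ℤ} {V : ℂ → ℂ}
    (hV : IsContinuousLog t ω V) {k : ℤ} (hk : k ≠ 0) : star (coeff V k) = coeff V k := by
  have hL := hV.hasLaurent ht
  have hLc := hL.conj
  obtain ⟨d, hd⟩ := exists_eq_const_of_exp_eq_one (hL.continuousOn.sub hLc.continuousOn)
    fun z hz => by
      have h2 : Complex.exp (star (V (star z))) = Complex.exp (V z) := by
        change Complex.exp (starRingEnd ℂ _) = _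
        rw [Complex.exp_conj, hV.2 _ (by simpa using hz), hV.2 z hz]
        change star (star z ^ (-ω) * symbol t (star z)) = _
        rw [star_mul', star_symbol_star]
        simp
      rw [Pi.sub_apply, Complex.exp_sub, h2, div_self (Complex.exp_ne_zero _)]
  have h1 := (hLc.add (hasLaurent_const d)).congr (k := V) fun z hz => by
    rw [← hd z hz, Pi.sub_apply, add_sub_cancel]
  have h2 := congrFun (h1.unique hL) k
  simpa [hk] using h2

/-! ### The Wiener-Hopf factorization -/

theorem HasLaurent.positivePart {a : ℤ → ℂ} {h : ℂ → ℂ} (ha : HasLaurent a h) :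
    HasLaurent (fun n => if 0 < n then a n else 0)
      fun z => ∑' k : ℕ, a ((k : ℤ) + 1) * z ^ ((k : ℤ) + 1) := by
  refine ⟨ha.1.of_nonneg_of_le (fun _ => norm_nonneg _) fun n => ?_, fun z hz => ?_⟩
  · dsimp only
    split_ifs <;> simp
  · have hinj : Function.Injective fun k : ℕ => (k : ℤ) + 1 := fun _ _ h => by simpa using h
    have h1 := ((ha.2 z hz).summable.comp_injective hinj).hasSum
    refine (hinj.hasSum_iff fun n hn => ?_).1 ?_
    · dsimp only
      rw [if_neg, zero_mul]
      intro h0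
      exact hn ⟨(n - 1).toNat, by simp; omega⟩
    · have e : ∀ k : ℕ, 0 < (k : ℤ) + 1 := fun k => by positivity
      simpa only [Function.comp_def, e, if_true] using h1

/-- The exponent `∑_{k ≥ 1} V_k z^k` of `b₊(z)`. -/
def plusExponent (V : ℂ → ℂ) (z : ℂ) : ℂ := ∑' k : ℕ, coeff V ((k : ℤ) + 1) * z ^ ((k : ℤ) + 1)

/-- The exponent `∑_{k ≥ 1} V_{-k} z^k` of `b₋(1/z)`. -/
def minusExponent (V : ℂ → ℂ) (z : ℂ) : ℂ :=
  ∑' k : ℕ, coeff V (-((k : ℤ) + 1)) * z ^ ((k : ℤ) + 1)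

theorem bPlus_eq (V : ℂ → ℂ) (z : ℂ) : bPlus V z = Complex.exp (plusExponent V z) := rfl

theorem bMinus_eq (V : ℂ → ℂ) (z : ℂ) : bMinus V z = Complex.exp (minusExponent V z⁻¹) := by
  simp only [bMinus, minusExponent, inv_zpow']

theorem laurentBound_plusExponent {V : ℂ → ℂ} (hV : HasLaurent (coeff V) V) :
    ∃ K, LaurentBound (AddSubmonoid.nonneg ℤ) K (plusExponent V) :=
  ⟨_, hV.positivePart.laurentBound fun _ hn => if_neg fun h => hn h.le⟩

theorem laurentBound_minusExponent {V : ℂ → ℂ} (hV : HasLaurent (coeff V) V) :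
    ∃ K, LaurentBound (AddSubmonoid.nonneg ℤ) K (minusExponent V) :=
  ⟨_, hV.inv.positivePart.laurentBound fun _ hn => if_neg fun h => hn h.le⟩

theorem HasLaurent.eq_exponents {V : ℂ → ℂ} (hV : HasLaurent (coeff V) V) {z : ℂ} (hz : ‖z‖ = 1) :
    V z = coeff V 0 + plusExponent V z + minusExponent V z⁻¹ := by
  have h1 := ((hasLaurent_const (coeff V 0)).add hV.positivePart).add hV.inv.positivePart.inv
  refine (hV.2 z hz).unique ?_
  unfold plusExponent minusExponent
  convert h1.2 z hz using 2 with n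
  rcases lt_trichotomy n 0 with h | rfl | h
  · simp [h.ne, h.not_gt, h]
  · simp
  · simp [h.ne', h.not_gt, h]

theorem differentiableOn_bPlus {V : ℂ → ℂ} (hV : Summable fun k => ‖coeff V k‖) :
    DifferentiableOn ℂ (bPlus V) {z | ‖z‖ < 1} := by
  have hinj : Function.Injective fun k : ℕ => (k : ℤ) + 1 := fun _ _ h => by simpa using h
  refine DifferentiableOn.cexp (Complex.differentiableOn_tsum_of_summable_norm (hV.comp_injective hinj)
    (fun k => ?_) (isOpen_lt continuous_norm continuous_const) fun k z hz => ?_)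
  · refine (differentiableOn_const _).mul fun z _ => ?_
    exact (differentiableAt_zpow.2 (.inr (by positivity))).differentiableWithinAt
  · rw [norm_mul, norm_zpow]
    refine mul_le_of_le_one_right (norm_nonneg _) ?_
    exact_mod_cast pow_le_one₀ (n := k + 1) (norm_nonneg z) (le_of_lt hz)

theorem differentiableOn_bMinus {V : ℂ → ℂ} (hV : Summable fun k => ‖coeff V k‖) :
    DifferentiableOn ℂ (bMinus V) {z | 1 < ‖z‖} := by
  have hinj : Function.Injective fun k : ℕ => -((k : ℤ) + 1) := fun _ _ h => by simpa using h
  refine DifferentiableOn.cexp (Complex.differentiableOn_tsum_of_summable_norm (hV.comp_injective hinj)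
    (fun k => ?_) (isOpen_lt continuous_const continuous_norm) fun k z hz => ?_)
  · refine (differentiableOn_const _).mul fun z hz => ?_
    refine (differentiableAt_zpow.2 (.inl ?_)).differentiableWithinAt
    exact norm_pos_iff.1 (zero_lt_one.trans hz)
  · rw [norm_mul, norm_zpow, ← inv_zpow']
    refine mul_le_of_le_one_right (norm_nonneg _) ?_
    exact_mod_cast pow_le_one₀ (n := k + 1) (inv_nonneg.2 (norm_nonneg z))
      (inv_le_one_of_one_le₀ (le_of_lt hz))

theorem LaurentBound.exp_neg {S : AddSubmonoid ℤ} {M : ℝ} {h : ℂ → ℂ} (hh : LaurentBound S M h) :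
    ∃ K, LaurentBound S K fun z => Complex.exp (-h z) := by
  obtain ⟨K, hK⟩ := (hh.const_mul (-1)).exp
  exact ⟨K, by simpa using hK⟩

/-- The constant coefficient of an invertible power series does not vanish. -/
theorem HasLaurent.coeff_zero_ne_zero {a b : ℤ → ℂ} {h k : ℂ → ℂ} (ha : HasLaurent a h)
    (hb : HasLaurent b k) (ha0 : ∀ n < 0, a n = 0) (hb0 : ∀ n < 0, b n = 0)
    (hk : ∀ z : ℂ, ‖z‖ = 1 → h z * k z = 1) : a 0 ≠ 0 := by
  intro h0
  have h1 := congrFun (((ha.mul hb).congr hk).unique (hasLaurent_const 1)) 0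
  rw [if_pos rfl, convolution] at h1
  -- By the supports, the constant term of the product is `a 0 * b 0`.
  have h2 : ∀ m, a (0 - m) * b m = 0 := by
    intro m
    rcases lt_trichotomy m 0 with hm | rfl | hm
    · rw [hb0 m hm, mul_zero]
    · rw [sub_zero, h0, zero_mul]
    · rw [ha0 _ (by omega), zero_mul]
  simp only [h2, tsum_zero, zero_ne_one] at h1

/-- If `F G = z^{-N} U(1/z)` with `G` and `U` power series in `z`, then the first `N` shifts of
`G` lie in the kernel of the half-infinite Toeplitz matrix of `F`. -/
theorem hasSum_toeplitz_eq_zero {a b u : ℤ → ℂ} {F G U : ℂ → ℂ} (ha : HasLaurent a F)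
    (hb : HasLaurent b G) (hu : HasLaurent u U) (hb0 : ∀ n < 0, b n = 0) (hu0 : ∀ n < 0, u n = 0)
    {N : ℕ} (hFG : ∀ z : ℂ, ‖z‖ = 1 → F z * G z = z ^ (-(N : ℤ)) * U z⁻¹) {m : ℕ} (hm : m < N)
    (n : ℕ) : HasSum (fun k : ℕ => a ((n : ℤ) - k) * b ((k : ℤ) - m)) 0 := by
  have h1 := congrFun (((ha.mul hb).congr hFG).unique (hu.inv.zpow_mul (-(N : ℤ)))) ((n : ℤ) - m)
  -- In degree `n - m` the right side has coefficient `u (m - n - N)`, of negative index because `m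
  -- < N` and `n ≥ 0`.
  rw [hu0 _ (by omega)] at h1
  have hs : Summable fun j => ‖a ((n : ℤ) - m - j) * b j‖ :=
    (summable_convolution ha.1 hb.1).prod_factor _
  have h2 : HasSum (fun j => a ((n : ℤ) - m - j) * b j) 0 := by
    have := (Summable.of_norm hs).hasSum
    rwa [show ∑' j, a ((n : ℤ) - m - j) * b j = 0 from h1] at this
  have h3 := (Equiv.subRight (m : ℤ)).hasSum_iff.2 h2
  -- Negative columns do not contribute, as `b (k - m) = 0` for `k < 0`; this turns the full
  -- convolution into the half-infinite sum.
  have h4 := (Nat.cast_injective (R := ℤ).hasSum_iff fun j hj => ?_).2 h3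
  · refine (congrArg (HasSum · 0) (funext fun k => ?_)).mp h4
    simp
  · have : j < 0 := by
      by_contra hj'
      exact hj ⟨j.toNat, by simp; omega⟩
    simp only [Function.comp_apply, Equiv.subRight_apply]
    rw [hb0 _ (by omega), mul_zero]

/-! ### The edge modes -/

/-- The expansion of an operator with absolutely summable coefficients in a bounded family. -/
theorem hasSum_smul_of_norm_le {χ : ℕ → FockOp} (hχ : ∀ n, ‖χ n‖ ≤ 2) {g : ℕ → ℂ}
    (hg : Summable fun n => ‖g n‖) : HasSum (fun n => g n • χ n) (∑' n, g n • χ n) := by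
  refine (Summable.of_norm_bounded (hg.mul_right 2) fun n => ?_).hasSum
  rw [norm_smul]
  exact mul_le_mul_of_nonneg_left (hχ n) (norm_nonneg _)

/-- The edge modes attached to a power series `G` with real coefficients. -/
theorem exists_zeroModes {t : ℤ → ℝ} {χ : ℕ → FockOp} (hχ : IsClifford χ) (hχ2 : ∀ n, ‖χ n‖ ≤ 2)
    {b : ℤ → ℂ} {G : ℂ → ℂ} (hb : HasLaurent b G) (hb0 : ∀ n < 0, b n = 0) (hb1 : b 0 ≠ 0)
    (hbr : ∀ n, ((b n).re : ℂ) = b n) {N : ℕ}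
    (hcomm : ∀ m < N, ∀ x : FockOp, (Summable fun n : ℕ => ‖b ((n : ℤ) - m)‖) →
      HasSum (fun n : ℕ => b ((n : ℤ) - m) • χ n) x → CommutesWithHamiltonian t x) :
    ∃ (g : Fin N → ℕ → ℝ) (Γ : Fin N → FockOp),
      (∀ m n, (g m n : ℂ) = coeff G ((n : ℤ) - (m : ℕ))) ∧
      LinearIndependent ℂ Γ ∧ ∀ m, IsZeroMode t χ (g m) (Γ m) := by
  have hs : ∀ m : ℕ, Summable fun n : ℕ => ‖b ((n : ℤ) - m)‖ := fun m =>
    hb.1.comp_injective (i := fun n : ℕ => (n : ℤ) - m) fun _ _ h => by simpa using h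
  have hΓ := fun m : ℕ => hasSum_smul_of_norm_le hχ2 (hs m)
  refine ⟨fun m n => (b ((n : ℤ) - (m : ℕ))).re,
    fun m => ∑' n : ℕ, b ((n : ℤ) - (m : ℕ)) • χ n, fun m n => ?_, ?_, fun m => ⟨?_, ?_, ?_⟩⟩
  · rw [hbr, hb.coeff_eq]
  · refine hχ.linearIndependent (fun m => hΓ m) (fun m n hmn => hb0 _ (by omega)) fun m => ?_
    rwa [sub_self]
  · have h1 : Summable fun n : ℕ => |(b ((n : ℤ) - (m : ℕ))).re| :=
      (hs m).of_nonneg_of_le (fun _ => abs_nonneg _) fun n => Complex.abs_re_le_norm _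
    refine (h1.mul_left (∑' n : ℕ, |(b ((n : ℤ) - (m : ℕ))).re|)).of_nonneg_of_le
      (fun _ => sq_nonneg _) fun n => ?_
    rw [← sq_abs, sq]
    exact mul_le_mul_of_nonneg_right (h1.le_tsum n fun _ _ => abs_nonneg _) (abs_nonneg _)
  · simp only [hbr]
    exact hΓ m
  · exact hcomm m m.2 _ (hs m) (hΓ m)

theorem commutesWithHamiltonian_of_majorana {t : ℤ → ℝ} (ht : Summable fun n => |t n|) {g : ℕ → ℂ}
    (hg : Summable fun n => ‖g n‖) {x : FockOp} (hx : HasSum (fun n => g n • majorana n) x)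
    (hker : ∀ n : ℕ, HasSum (fun m : ℕ => (t (-((n : ℤ) - m)) : ℂ) * g m) 0) :
    CommutesWithHamiltonian t x := by
  have hw : Summable fun n => ‖(t (-n) : ℂ)‖ := by
    simpa [Function.comp_def] using (Equiv.neg ℤ).summable_iff.2 ht
  have h := majorana_isClifford.hasSum_commutator
    (fun n m => by rw [majoranaTilde_mul_majorana, neg_neg]) norm_majoranaTilde_le hg hx hw hker
    (Complex.I / 2)
  simp only [neg_sub] at h
  exact h

/-- Exchanging the two Majorana factors and their summation indices gives the same form with
prefactor `-i/2` and transposed matrix: hence `t (n - m)`, the symbol `f(z)` and the factor `b₊`. -/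
theorem commutesWithHamiltonian_of_majoranaTilde {t : ℤ → ℝ} (ht : Summable fun n => |t n|)
    {g : ℕ → ℂ} (hg : Summable fun n => ‖g n‖) {x : FockOp}
    (hx : HasSum (fun n => g n • majoranaTilde n) x)
    (hker : ∀ n : ℕ, HasSum (fun m : ℕ => (t ((n : ℤ) - m) : ℂ) * g m) 0) :
    CommutesWithHamiltonian t x := by
  have hw : Summable fun n => ‖(t n : ℂ)‖ := by simpa using ht
  have h := majoranaTilde_isClifford.hasSum_commutator majoranaTilde_mul_majorana
    norm_majorana_le hg hx hw hker (-(Complex.I / 2))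
  have h2 := (Equiv.prodComm ℕ ℕ).hasSum_iff.2 h
  refine (congrArg (HasSum · 0) (funext fun p => ?_)).mp h2
  have e : hamiltonianTerm t p = (-(Complex.I / 2) * (t ((p.2 : ℤ) - p.1) : ℂ)) •
      (majorana p.2 * majoranaTilde p.1) := by
    rw [hamiltonianTerm, majoranaTilde_mul_majorana, smul_neg, neg_mul, neg_smul]
  rw [e]
  rfl

theorem IsContinuousLog.star_plusExponent {t : ℤ → ℝ} (ht : Summable fun n => |t n|) {ω : ℤ}
    {V : ℂ → ℂ} (hV : IsContinuousLog t ω V) (z : ℂ) :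
    star (plusExponent V (star z)) = plusExponent V z := by
  rw [plusExponent, tsum_star, plusExponent]
  refine tsum_congr fun k => ?_
  rw [star_mul', hV.star_coeff ht (by omega)]
  simp

theorem IsContinuousLog.star_minusExponent {t : ℤ → ℝ} (ht : Summable fun n => |t n|) {ω : ℤ}
    {V : ℂ → ℂ} (hV : IsContinuousLog t ω V) (z : ℂ) :
    star (minusExponent V (star z)) = minusExponent V z := by
  rw [minusExponent, tsum_star, minusExponent]
  refine tsum_congr fun k => ?_
  rw [star_mul', hV.star_coeff ht (by omega)]
  simp

/-- The power series `exp (-E)`: its coefficients are real and supported in degrees `≥ 0`, and the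
constant one does not vanish. -/
theorem exists_hasLaurent_exp_neg {E : ℂ → ℂ} {K : ℝ}
    (hE : LaurentBound (AddSubmonoid.nonneg ℤ) K E) (hEr : ∀ z, star (E (star z)) = E z) :
    ∃ b, HasLaurent b (fun z => Complex.exp (-E z)) ∧ (∀ n < 0, b n = 0) ∧ b 0 ≠ 0 ∧
      ∀ n, ((b n).re : ℂ) = b n := by
  obtain ⟨_, b, hb, -, hb0⟩ := hE.exp_neg
  -- The inverse `exp E` is also a power series, which forces `b 0 ≠ 0`.
  obtain ⟨_, c, hc, -, hc0⟩ := hE.exp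
  have hb0' : ∀ n < 0, b n = 0 := fun n hn => hb0 n fun h => absurd h hn.not_ge
  have hc0' : ∀ n < 0, c n = 0 := fun n hn => hc0 n fun h => absurd h hn.not_ge
  refine ⟨b, hb, hb0', hb.coeff_zero_ne_zero hc hb0' hc0' fun z _ => ?_,
    hb.ofReal_re_coeff_eq fun z _ => ?_⟩
  · rw [← Complex.exp_add, neg_add_cancel, Complex.exp_zero]
  · change starRingEnd ℂ _ = _
    rw [← Complex.exp_conj, map_neg]
    exact congrArg (fun w => Complex.exp (-w)) (hEr z)

theorem IsContinuousLog.exists_majorana_zeroModes {t : ℤ → ℝ} (ht : Summable fun n => |t n|)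
    {ω : ℤ} {V : ℂ → ℂ} (hV : IsContinuousLog t ω V) (hω : 0 < ω) :
    ∃ (g : Fin ω.natAbs → ℕ → ℝ) (Γ : Fin ω.natAbs → FockOp),
      (∀ m n, (g m n : ℂ) = coeff (fun z => 1 / bMinus V (1 / z)) ((n : ℤ) - (m : ℕ))) ∧
      LinearIndependent ℂ Γ ∧ ∀ m, IsZeroMode t majorana (g m) (Γ m) := by
  have hL := hV.hasLaurent ht
  obtain ⟨_, hQ⟩ := laurentBound_minusExponent hL
  obtain ⟨_, hP⟩ := laurentBound_plusExponent hL
  obtain ⟨b, hb, hb0, hb1, hbr⟩ := exists_hasLaurent_exp_neg hQ (hV.star_minusExponent ht)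
  have hG : (fun z => 1 / bMinus V (1 / z)) = fun z => Complex.exp (-minusExponent V z) := by
    funext z
    rw [bMinus_eq, one_div, one_div, inv_inv, Complex.exp_neg]
  rw [hG]
  obtain ⟨_, hexp⟩ := hP.exp
  -- Here `U = e^{V_0} b₊`, and the relation needed is `f(1/z) / b₋(1/z) = z^{-ω} U(1/z)`.
  obtain ⟨u, hu, -, hu0⟩ := hexp.const_mul (Complex.exp (coeff V 0))
  refine exists_zeroModes majorana_isClifford norm_majorana_le hb hb0 hb1 hbr
    fun m hm x hg hx => commutesWithHamiltonian_of_majorana ht hg hx fun n =>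
      hasSum_toeplitz_eq_zero (hasLaurent_symbol ht).inv hb hu hb0
        (fun n hn => hu0 n fun h => absurd h hn.not_ge) (fun z hz => ?_) hm n
  have hz' : ‖z⁻¹‖ = 1 := by simp [hz]
  rw [hV.symbol_eq hz', hL.eq_exponents hz', inv_inv, Int.natCast_natAbs, abs_of_pos hω, inv_zpow',
    Complex.exp_add, Complex.exp_add, Complex.exp_neg]
  have := Complex.exp_ne_zero (minusExponent V z)
  field_simp

theorem IsContinuousLog.exists_majoranaTilde_zeroModes {t : ℤ → ℝ} (ht : Summable fun n => |t n|)
    {ω : ℤ} {V : ℂ → ℂ} (hV : IsContinuousLog t ω V) (hω : ω < 0) :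
    ∃ (g : Fin ω.natAbs → ℕ → ℝ) (Γ : Fin ω.natAbs → FockOp),
      (∀ m n, (g m n : ℂ) = coeff (fun z => 1 / bPlus V z) ((n : ℤ) - (m : ℕ))) ∧
      LinearIndependent ℂ Γ ∧ ∀ m, IsZeroMode t majoranaTilde (g m) (Γ m) := by
  have hL := hV.hasLaurent ht
  obtain ⟨_, hQ⟩ := laurentBound_minusExponent hL
  obtain ⟨_, hP⟩ := laurentBound_plusExponent hL
  obtain ⟨b, hb, hb0, hb1, hbr⟩ := exists_hasLaurent_exp_neg hP (hV.star_plusExponent ht)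
  have hG : (fun z => 1 / bPlus V z) = fun z => Complex.exp (-plusExponent V z) := by
    funext z
    rw [bPlus_eq, one_div, Complex.exp_neg]
  rw [hG]
  obtain ⟨_, hexp⟩ := hQ.exp
  -- Here `U(z) = e^{V_0} b₋(1/z)`, and the relation needed is `f(z) / b₊(z) = z^{-|ω|} U(1/z)`.
  obtain ⟨u, hu, -, hu0⟩ := hexp.const_mul (Complex.exp (coeff V 0))
  refine exists_zeroModes majoranaTilde_isClifford norm_majoranaTilde_le hb hb0 hb1 hbr
    fun m hm x hg hx => commutesWithHamiltonian_of_majoranaTilde ht hg hx fun n =>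
      hasSum_toeplitz_eq_zero (hasLaurent_symbol ht) hb hu hb0
        (fun n hn => hu0 n fun h => absurd h hn.not_ge) (fun z hz => ?_) hm n
  rw [hV.symbol_eq hz, hL.eq_exponents hz, Int.natCast_natAbs, abs_of_neg hω, neg_neg,
    Complex.exp_add, Complex.exp_add, Complex.exp_neg]
  have := Complex.exp_ne_zero (plusExponent V z)
  field_simp

end BDIChain

end

open BDIChain

theorem theorem1 (t : ℤ → ℝ) (ht : Summable fun n => |t n|) (hgap : IsGapped t)
    (ω : ℤ) (hω : HasWindingNumber (symbol t) ω) :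
    -- there are `|ω|` linearly independent zero-energy edge modes
    (∃ Γ : Fin ω.natAbs → FockOp, LinearIndependent ℂ Γ ∧ ∀ m, IsEdgeMode t (Γ m)) ∧
    -- `z^{-ω} f(z)` has a continuous logarithm on the unit circle, and each one gives:
    (∃ V : ℂ → ℂ, IsContinuousLog t ω V) ∧
    ∀ V : ℂ → ℂ, IsContinuousLog t ω V →
      -- the Wiener-Hopf factorization
      ((Summable fun k : ℤ => ‖coeff V k‖) ∧
        DifferentiableOn ℂ (bPlus V) {z | ‖z‖ < 1} ∧
        DifferentiableOn ℂ (bMinus V) {z | 1 < ‖z‖} ∧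
        ∀ z : ℂ, ‖z‖ = 1 →
          symbol t z = Complex.exp (coeff V 0) * (z ^ ω * bPlus V z * bMinus V z)) ∧
      -- the real edge modes for positive winding number
      (0 < ω → ∃ (g : Fin ω.natAbs → ℕ → ℝ) (Γ : Fin ω.natAbs → FockOp),
        (∀ m n, (g m n : ℂ) = coeff (fun z => 1 / bMinus V (1 / z)) ((n : ℤ) - (m : ℕ))) ∧
        LinearIndependent ℂ Γ ∧ ∀ m, IsZeroMode t majorana (g m) (Γ m)) ∧
      -- the imaginary edge modes for negative winding number
      (ω < 0 → ∃ (g : Fin ω.natAbs → ℕ → ℝ) (Γ : Fin ω.natAbs → FockOp),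
        (∀ m n, (g m n : ℂ) = coeff (fun z => 1 / bPlus V z) ((n : ℤ) - (m : ℕ))) ∧
        LinearIndependent ℂ Γ ∧ ∀ m, IsZeroMode t majoranaTilde (g m) (Γ m)) := by

  obtain ⟨V₀, hV₀⟩ := exists_isContinuousLog ht hgap hω
  refine ⟨?_, ⟨V₀, hV₀⟩, fun V hV => ⟨⟨?_, ?_, ?_, fun z hz => ?_⟩,
    hV.exists_majorana_zeroModes ht, hV.exists_majoranaTilde_zeroModes ht⟩⟩
  · rcases lt_trichotomy ω 0 with h | rfl | h
    · obtain ⟨g, Γ, -, hΓ, hm⟩ := hV₀.exists_majoranaTilde_zeroModes ht h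
      exact ⟨Γ, hΓ, fun m => ⟨g m, .inr (hm m)⟩⟩
    · have : IsEmpty (Fin (0 : ℤ).natAbs) := Fin.isEmpty
      exact ⟨fun _ => 0, linearIndependent_empty_type, fun m => isEmptyElim m⟩
    · obtain ⟨g, Γ, -, hΓ, hm⟩ := hV₀.exists_majorana_zeroModes ht h
      exact ⟨Γ, hΓ, fun m => ⟨g m, .inl (hm m)⟩⟩
  · exact (hV.hasLaurent ht).1
  · exact differentiableOn_bPlus (hV.hasLaurent ht).1
  · exact differentiableOn_bMinus (hV.hasLaurent ht).1
  · rw [hV.symbol_eq hz, (hV.hasLaurent ht).eq_exponents hz, Complex.exp_add, Complex.exp_add,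
      bPlus_eq, bMinus_eq]
    ring
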